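/- Let $r\ge 2$ and $s\ge r+1$ be integers such that $r=2$ or $(r+1)^2>s(r-1)$. Let $Y=Y^r_s$ be the blowup of $\mathbb P^r$ at $s$ general points, and let $A^{r-1}(Y)$ be the free abelian group of curve classes with basis $h,e_1,\dots,e_s$ ($h$ the class of a general line, $e_i$ the class of a line in the $i$-th exceptional divisor). Write $(d;m_1,\dots,m_s)=dh-\sum_i m_ie_i$, and call $d$ the degree and the $m_i$ the multiplicities. Let $\langle-,-\rangle$ be the symmetric bilinear form with $\langle h,h\rangle=1$, $\langle e_i,e_i\rangle=1-r$ and distinct basis elements orthogonal, and put $F=(r+1)h-\sum_i e_i$. For a set $I$ of $r+1$ indices, the standard Cremona transformation $\phi_I$ acts on $A^{r-1}(Y)$ by $d\mapsto d+(r-1)t$, $m_i\mapsto m_i+t$ for $i\in I$, $m_i\mapsto m_i$ for $i\notin I$, where $t=d-\sum_{i\in I}m_i$. The Weyl group is generated by all $\phi_I$ and all permutations of the $e_i$. A class is the class of a $(-1)$-Weyl line if it is in the Weyl group orbit of $h-e_1-e_2$. A class is Cremona reduced if $d\ge\sum_{i\in I}m_i$ for every $I$ with $|I|=r+1$. The reduction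 algorithm repeats the following: (1) reorder the multiplicities in non-increasing order; (2) if the class is Cremona reduced, stop; (3) otherwise apply $\phi_{\{1,\dots,r+1\}}$ and go to (1). The algorithm "passes through" the ordered classes obtained in step (1), and "ends at" the class at which it stops. Finally, let $R_{r,s}$ be the following class (exponents denote repetition): - $r=2$, $s\ge 3$: $(0;0^{s-1},-1)$; - $r\ge 3$, $s=r+1$: $(2-r;0^2,(-1)^{r-1})$; - $r\ge 3$, $s=r+2$: $(2-r;0^3,(-1)^{r-1})$; - $r=2k\ge 4$, $s=r+3$: $((2k+1)(1-k);(1-k)^{r+2},-k)$; - $r=2k+1\ge 3$, $s=r+3$: $(-2k^2-2k+1;(-k)^{r+3})$; - $r=3$, $s=7$: $(-3;0,(-1)^6)$; - $r=4$, $s=8$: $(-14;-2,(-3)^7)$. Let $c\in A^{r-1}(Y)$ have positive degree and non-negative multiplicities, with $\langle c,F\rangle=3-r$. Then: (a) If $c$ is Cremona reduced, then $c$ is not the class of a $(-1)$-Weyl line. (b) If $(r+1)^2>s(r-1)$, then the reduction algorithm started at $c$ terminates. (c) Assume moreover, if $r=2$ and $s=9$, that $\langle c,c\rangle=3-2r$.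 Then the following are equivalent: 1. $c$ is the class of a $(-1)$-Weyl line; 2. the reduction algorithm started at $c$ ends, and it ends at $R_{r,s}$; 3. the reduction algorithm started at $c$ ends, and it ends at a class congruent to $R_{r,s}$ modulo $\mathbb ZF$; 4. the reduction algorithm started at $c$ passes through $h-e_1-e_2$. If $c$ is not of the form $h-e_i-e_j$ with $i\ne j$, these are also equivalent to: 5. $s\ge r+3$, and the reduction algorithm started at $c$ passes through the class $(r;1^{r+3},0^{s-r-3})$ of the rational normal curve of degree $r$ through $r+3$ of the points. -/

import Mathlib

namespace CremonaCurves

/-- The group `A^{r-1}(Y^r_s)` of curve classes of the blowup of `ℙ^r` at `s` general points, in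
coordinates: it is free on `h, e_1, …, e_s`, and the pair `(d, m)` stands for the class
`d h - ∑ i, m i • e_i` of degree `d` with multiplicities `m i`. The point `p_{i+1}` has
index `i : Fin s`. -/
abbrev CurveClass (s : ℕ) : Type := ℤ × (Fin s → ℤ)

/-- The anticanonical curve class `F = (r+1) h - ∑ i, e_i`. -/
def anticanonical (r s : ℕ) : CurveClass s := ((r : ℤ) + 1, fun _ => 1)

/-- The quadratic form `q (d; m) = d^2 - (r-1) ∑ i, m_i^2`. -/
def quad (r : ℕ) {s : ℕ} (x : CurveClass s) : ℤ :=
  x.1 ^ 2 - ((r : ℤ) - 1) * ∑ i, x.2 i ^ 2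

/-- The bilinear form `⟨x, y⟩` on curve classes: `⟨h, h⟩ = 1`, `⟨e_i, e_i⟩ = 1 - r`, and distinct
basis elements are orthogonal. -/
def pairing (r : ℕ) {s : ℕ} (x y : CurveClass s) : ℤ :=
  x.1 * y.1 - ((r : ℤ) - 1) * ∑ i, x.2 i * y.2 i

theorem two_mul_pairing (r : ℕ) {s : ℕ} (x y : CurveClass s) :
    2 * pairing r x y = quad r (x + y) - quad r x - quad r y := by
  have h : ∑ i, (x.2 i + y.2 i) ^ 2
      = ∑ i, x.2 i ^ 2 + 2 * ∑ i, x.2 i * y.2 i + ∑ i, y.2 i ^ 2 := by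
    rw [Finset.mul_sum, ← Finset.sum_add_distrib, ← Finset.sum_add_distrib]
    exact Finset.sum_congr rfl fun i _ => by ring
  simp only [pairing, quad, Prod.fst_add, Prod.snd_add, Pi.add_apply, h]
  ring

/-- The action of the standard Cremona transformation `φ_I` on curve classes. -/
def cremona (r : ℕ) {s : ℕ} (I : Finset (Fin s)) (c : CurveClass s) : CurveClass s :=
  (c.1 + ((r : ℤ) - 1) * (c.1 - ∑ j ∈ I, c.2 j),
    fun i => if i ∈ I then c.2 i + (c.1 - ∑ j ∈ I, c.2 j) else c.2 i)

theorem cremona_cremona (r : ℕ) {s : ℕ} (I : Finset (Fin s)) (hI : I.card = r + 1)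
    (c : CurveClass s) : cremona r I (cremona r I c) = c := by
  have h : ∑ j ∈ I, (cremona r I c).2 j
      = ∑ j ∈ I, c.2 j + ((r : ℤ) + 1) * (c.1 - ∑ j ∈ I, c.2 j) := by
    rw [Finset.sum_congr rfl (g := fun j => c.2 j + (c.1 - ∑ j ∈ I, c.2 j))
      (fun j hj => by simp [cremona, hj]), Finset.sum_add_distrib, Finset.sum_const, hI]
    simp
  have h1 : (cremona r I c).1 - ∑ j ∈ I, (cremona r I c).2 j = -(c.1 - ∑ j ∈ I, c.2 j) := by
    rw [h]; simp only [cremona]; ring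
  refine Prod.ext ?_ (funext fun i => ?_)
  · change (cremona r I c).1 + ((r : ℤ) - 1) * _ = _
    rw [h1]; simp only [cremona]; ring
  · change (if i ∈ I then (cremona r I c).2 i + _ else (cremona r I c).2 i) = _
    rw [h1]
    by_cases hi : i ∈ I
    · simp only [cremona, hi, if_true]; ring
    · simp [cremona, hi]

theorem cremona_add (r : ℕ) {s : ℕ} (I : Finset (Fin s)) (x y : CurveClass s) :
    cremona r I (x + y) = cremona r I x + cremona r I y := by
  refine Prod.ext ?_ (funext fun i => ?_)
  · simp only [cremona, Prod.fst_add, Prod.snd_add, Pi.add_apply, Finset.sum_add_distrib]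
    ring
  · by_cases hi : i ∈ I
    · simp only [cremona, Prod.fst_add, Prod.snd_add, Pi.add_apply, Finset.sum_add_distrib, hi,
        if_true]
      ring
    · simp [cremona, hi]

/-- `φ_I`, for `I` a set of `r + 1` indices, as an automorphism of the group of curve classes. -/
def cremonaAut (r : ℕ) {s : ℕ} (I : Finset (Fin s)) (hI : I.card = r + 1) :
    CurveClass s ≃ₗ[ℤ] CurveClass s where
  toFun := cremona r I
  invFun := cremona r I
  left_inv := cremona_cremona r I hI
  right_inv := cremona_cremona r I hI
  map_add' := cremona_add r I
  map_smul' n x := map_zsmul (AddMonoidHom.mk' (cremona r I) (cremona_add r I)) n x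

/-- The action of a permutation of the `s` points on curve classes. -/
def permAut {s : ℕ} (σ : Equiv.Perm (Fin s)) : CurveClass s ≃ₗ[ℤ] CurveClass s where
  toFun c := (c.1, fun i => c.2 (σ i))
  invFun c := (c.1, fun i => c.2 (σ.symm i))
  left_inv c := by simp
  right_inv c := by simp
  map_add' _ _ := rfl
  map_smul' _ _ := rfl

/-- The Weyl group: generated by the permutations of the points and the standard Cremona
transformations. -/
def weylGroup (r s : ℕ) : Subgroup (CurveClass s ≃ₗ[ℤ] CurveClass s) :=
  Subgroup.closure
    ({g | ∃ σ : Equiv.Perm (Fin s), g = permAut σ} ∪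
      {g | ∃ (I : Finset (Fin s)) (hI : I.card = r + 1), g = cremonaAut r I hI})

/-- The class `h - e_1 - e_2` of the line through the first two points. -/
def lineClass (s : ℕ) : CurveClass s := (1, fun i => if (i : ℕ) < 2 then 1 else 0)

/-- `c` is the class of a `(-1)`-Weyl line: it is in the Weyl group orbit of `h - e_1 - e_2`. -/
def IsWeylLine (r : ℕ) {s : ℕ} (c : CurveClass s) : Prop :=
  c ∈ MulAction.orbit (weylGroup r s) (lineClass s)

/-- The class `r h - e_1 - ⋯ - e_{r+3}` of the rational normal curve through the first `r + 3`
points (meaningful if `r + 3 ≤ s`). -/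
def rncClass (r s : ℕ) : CurveClass s := ((r : ℤ), fun i => if (i : ℕ) < r + 3 then 1 else 0)

/-- Cremona reduced curve classes. -/
def IsCremonaReduced (r : ℕ) {s : ℕ} (c : CurveClass s) : Prop :=
  ∀ I : Finset (Fin s), I.card = r + 1 → ∑ i ∈ I, c.2 i ≤ c.1

/-- The class `c` with its multiplicities reordered in non-increasing order. -/
def sortDesc {s : ℕ} (c : CurveClass s) : CurveClass s :=
  (c.1, c.2 ∘ Tuple.sort fun i => -c.2 i)

theorem sortDesc_antitone {s : ℕ} (c : CurveClass s) : Antitone (sortDesc c).2 := by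
  intro i j hij
  have h := Tuple.monotone_sort (fun i => -c.2 i) hij
  simpa [sortDesc] using h

/-- The set of the first `r + 1` indices. -/
def firstIndices (r s : ℕ) : Finset (Fin s) := Finset.univ.filter fun i => (i : ℕ) < r + 1

/-- One pass of the Cremona reduction algorithm, from an ordered class `x` to the next ordered
class `y`: if `x` is not Cremona reduced, apply `φ` to the first (largest) `r + 1` multiplicities
and reorder. There is no pass from a Cremona reduced class, where the algorithm stops. -/
def ReductionStep (r : ℕ) {s : ℕ} (x y : CurveClass s) : Prop :=
  ¬ IsCremonaReduced r x ∧ y = sortDesc (cremona r (firstIndices r s) x)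

/-- The reduction algorithm, started at `c`, passes through the ordered class `x`. -/
def ReducesTo (r : ℕ) {s : ℕ} (c x : CurveClass s) : Prop :=
  Relation.ReflTransGen (ReductionStep r) (sortDesc c) x

/-- The reduction algorithm, started at `c`, stops, and its result is `R`. -/
def EndsAt (r : ℕ) {s : ℕ} (c R : CurveClass s) : Prop :=
  ReducesTo r c R ∧ IsCremonaReduced r R

/-- The table of the Cremona reduced classes `R_{r,s}`, for `r = 2`, `s ≥ 3` and for `r ≥ 3`,
`s ≥ r + 1` with `(r+1)^2 > s (r-1)`. The last value is a placeholder outside this range. -/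
def reducedClass (r s : ℕ) : CurveClass s :=
  if r = 2 then
    (0, fun i => if (i : ℕ) + 1 = s then -1 else 0)
  else if s = r + 1 then
    (2 - (r : ℤ), fun i => if (i : ℕ) < 2 then 0 else -1)
  else if s = r + 2 then
    (2 - (r : ℤ), fun i => if (i : ℕ) < 3 then 0 else -1)
  else if s = r + 3 then
    let k : ℤ := ((r / 2 : ℕ) : ℤ)
    if Even r then
      ((2 * k + 1) * (1 - k), fun i => if (i : ℕ) + 1 = s then -k else 1 - k)
    else
      (-2 * k ^ 2 - 2 * k + 1, fun _ => -k)
  else if r = 3 ∧ s = 7 then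
    (-3, fun i => if (i : ℕ) = 0 then 0 else -1)
  else if r = 4 ∧ s = 8 then
    (-14, fun i => if (i : ℕ) = 0 then -2 else -3)
  else 0

end CremonaCurves

/-!
The class `R` of the table is ordered and Cremona reduced, that is, dominant for the simple roots
of the Weyl group (the transpositions of consecutive points and the Cremona transformation of the
first `r + 1` points), and it lies in the orbit of the line (`reducedClass_spec`).

The Cartan matrix is simply laced, so reflecting in coroots that are negative on the current class
is a "numbers game" with the strong convergence property `Descends.exchange`. It follows that every
class in the orbit of a dominant class descends to it (`exists_descends_of_mem_orbit`). Hence an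
orbit contains at most one ordered Cremona reduced class
(`eq_of_mem_orbit_of_isCremonaReduced`), which has the least degree in the orbit
(`degree_le_of_mem_orbit`). As each pass of the algorithm lowers the degree, the algorithm started
at a Weyl line ends, and ends at `R`; as `R` has degree at most `0`, a class of positive degree
that is Cremona reduced is not a Weyl line. If `⟨F, F⟩ > 0`, the degree is bounded below on every
orbit by the Cauchy–Schwarz inequality (`exists_endsAt`). The classes congruent to `R` modulo `ℤ F`
are told apart by the two invariants `⟨·, F⟩` and `⟨·, ·⟩`.

That a Weyl line of positive degree with non-negative multiplicities passes through the line
amounts to the fact that a pass of the algorithm preserves these sign conditions unless it starts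
at the line (`IsWeylLine.eq_lineClass_or_cremona_pos`). For `r = 2` the multiplicities of a Weyl
line are non-negative except for the classes `e_i`, since the last multiplicity grows along the
ascent from `R = e_s` (`IsWeylLine.last_nonneg`). For `r ≥ 3` a pass lowers the multiplicities by
exactly `1` (`IsWeylLine.neg_one_le`), because the class of the line is minuscule if `s ≤ r + 3`,
and by Cauchy–Schwarz in the remaining two cases; a pass from a class with a vanishing
multiplicity among the first `r + 1` then starts in degree `1`. Finally, the rational normal curve
is the only class from which one pass leads to the line (`ReductionStep.eq_rncClass`).
-/

namespace CremonaCurves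

/-! ### The numbers game of a simply laced Cartan matrix -/

section NumbersGame

variable {M ι : Type*} [AddCommGroup M]

/-- The reflection with coroot `t i` and root `α i`; the normalization is `t i (α i) = -2`. -/
def rootReflection (t : ι → M →+ ℤ) (α : ι → M) (i : ι) (x : M) : M := x + t i x • α i

/-- The coroots `t` and roots `α` have a simply laced generalized Cartan matrix (up to sign):
the diagonal entries are `-2` and distinct indices either do not interact or form an `A₂`. -/
structure IsSimplyLaced (t : ι → M →+ ℤ) (α : ι → M) : Prop where
  self : ∀ i, t i (α i) = -2
  ne : ∀ i j, i ≠ j → t i (α j) = 0 ∧ t j (α i) = 0 ∨ t i (α j) = 1 ∧ t j (α i) = 1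

/-- `Descends t α n x z`: the dominant element `z` is reached from `x` by `n` reflections, each
in a coroot that is negative on the current element. -/
inductive Descends (t : ι → M →+ ℤ) (α : ι → M) : ℕ → M → M → Prop
  | dominant {z : M} : (∀ i, 0 ≤ t i z) → Descends t α 0 z z
  | step {n : ℕ} {x z : M} (i : ι) : t i x < 0 →
      Descends t α n (rootReflection t α i x) z → Descends t α (n + 1) x z

variable {t : ι → M →+ ℤ} {α : ι → M}

theorem Descends.eq_of_dominant {n : ℕ} {x z : M} (h : Descends t α n x z)
    (hx : ∀ i, 0 ≤ t i x) : x = z := by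
  cases h with
  | dominant => rfl
  | step i hi _ => exact absurd (hx i) (not_le.2 hi)

theorem Descends.exists_succ {n : ℕ} {x z : M} (h : Descends t α n x z) {i : ι}
    (hi : t i x < 0) : ∃ k, n = k + 1 := by
  cases h with
  | dominant h => exact absurd (h i) (not_le.2 hi)
  | step => exact ⟨_, rfl⟩

theorem coroot_rootReflection (i j : ι) (x : M) :
    t j (rootReflection t α i x) = t j x + t i x * t j (α i) := by
  simp [rootReflection]

/-- Strong convergence of the numbers game: if `x` descends to `z` in `n + 1` moves, then after
any legal first move it descends to `z` in `n` moves. Two different first moves are completed to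
a square or to a hexagon. -/
theorem Descends.exchange (ht : IsSimplyLaced t α) {n : ℕ} : ∀ {x z : M} {i : ι},
    Descends t α (n + 1) x z → t i x < 0 → Descends t α n (rootReflection t α i x) z := by
  induction n using Nat.strong_induction_on with
  | _ n ih =>
    intro x z i h hi
    cases h with
    | step j hj h =>
      by_cases hij : i = j
      · subst hij; exact h
      rcases ht.ne i j hij with ⟨h1, h2⟩ | ⟨h1, h2⟩
      · have hi' : t i (rootReflection t α j x) < 0 := by
          rw [coroot_rootReflection, h1]; linarith
        obtain ⟨k, rfl⟩ := h.exists_succ hi'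
        have e : rootReflection t α i (rootReflection t α j x)
            = rootReflection t α j (rootReflection t α i x) := by
          simp only [rootReflection, map_add, map_zsmul, h1, h2, smul_zero, add_zero]
          abel
        have h' := ih k (by omega) h hi'
        rw [e] at h'
        refine .step j ?_ h'
        rw [coroot_rootReflection, h2]; linarith
      · have hi' : t i (rootReflection t α j x) < 0 := by
          rw [coroot_rootReflection, h1]; linarith
        obtain ⟨k, rfl⟩ := h.exists_succ hi'
        have h' := ih k (by omega) h hi'
        have hj' : t j (rootReflection t α i (rootReflection t α j x)) < 0 := by
          rw [coroot_rootReflection, coroot_rootReflection, coroot_rootReflection, h1, h2,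
            ht.self]
          linarith
        obtain ⟨l, rfl⟩ := h'.exists_succ hj'
        have h'' := ih l (by omega) h' hj'
        have e : rootReflection t α j (rootReflection t α i (rootReflection t α j x))
            = rootReflection t α i (rootReflection t α j (rootReflection t α i x)) := by
          simp only [rootReflection, map_add, map_zsmul, h1, h2, ht.self, smul_eq_mul]
          module
        rw [e] at h''
        refine .step j ?_ (.step i ?_ h'')
        · rw [coroot_rootReflection, h2]; linarith
        · rw [coroot_rootReflection, coroot_rootReflection, coroot_rootReflection, h1, h2,
            ht.self]
          linarith

theorem rootReflection_rootReflection (ht : IsSimplyLaced t α) (i : ι) (x : M) :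
    rootReflection t α i (rootReflection t α i x) = x := by
  simp only [rootReflection, map_add, map_zsmul, ht.self, smul_eq_mul]
  module

/-- The elements that descend to `z` are stable under the simple reflections. -/
theorem Descends.rootReflection (ht : IsSimplyLaced t α) {n : ℕ} {x z : M}
    (h : Descends t α n x z) (i : ι) : ∃ k, Descends t α k (rootReflection t α i x) z := by
  rcases lt_trichotomy (t i x) 0 with hi | hi | hi
  · obtain ⟨k, rfl⟩ := h.exists_succ hi
    exact ⟨k, h.exchange ht hi⟩
  · refine ⟨n, ?_⟩
    simpa [CremonaCurves.rootReflection, hi] using h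
  · refine ⟨n + 1, .step i ?_ ?_⟩
    · rw [coroot_rootReflection, ht.self]; linarith
    · rwa [rootReflection_rootReflection ht]

end NumbersGame

/-! ### The Weyl group and its simple reflections -/

theorem permAut_apply {s : ℕ} (σ : Equiv.Perm (Fin s)) (c : CurveClass s) :
    permAut σ c = (c.1, fun i => c.2 (σ i)) := rfl

theorem mem_firstIndices {r s : ℕ} {i : Fin s} : i ∈ firstIndices r s ↔ (i : ℕ) < r + 1 := by
  simp [firstIndices]

theorem card_firstIndices {r s : ℕ} (hs : r + 1 ≤ s) : (firstIndices r s).card = r + 1 := by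
  rw [firstIndices, Fin.card_filter_val_lt, min_eq_right hs]

theorem cremona_permAut (r : ℕ) {s : ℕ} (σ : Equiv.Perm (Fin s)) (I J : Finset (Fin s))
    (h : ∀ i, σ i ∈ J ↔ i ∈ I) (c : CurveClass s) :
    cremona r I (permAut σ c) = permAut σ (cremona r J c) := by
  have hsum : ∑ j ∈ I, c.2 (σ j) = ∑ j ∈ J, c.2 j :=
    Finset.sum_equiv σ (fun i => (h i).symm) fun _ _ => rfl
  simp only [cremona, permAut_apply, hsum, h]

theorem exists_perm_mem_iff {s : ℕ} {I J : Finset (Fin s)} (h : I.card = J.card) :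
    ∃ σ : Equiv.Perm (Fin s), ∀ i, σ i ∈ J ↔ i ∈ I := by
  refine ⟨(Finset.equivOfCardEq h).extendSubtype, fun i => ⟨fun hi => ?_, fun hi => ?_⟩⟩
  · by_contra hn
    exact Equiv.extendSubtype_not_mem _ i hn hi
  · exact Equiv.extendSubtype_mem _ i hi

/-- The simple coroots on curve classes: `d - m_1 - ⋯ - m_{r+1}` (index `none`) and the
differences of consecutive multiplicities. They are all non-negative exactly on the ordered
Cremona reduced classes. -/
def simpleCoroot (r n : ℕ) : Option (Fin n) → CurveClass (n + 1) →+ ℤ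
  | none => AddMonoidHom.mk' (fun c => c.1 - ∑ j ∈ firstIndices r (n + 1), c.2 j) fun x y => by
      simp only [Prod.fst_add, Prod.snd_add, Pi.add_apply, Finset.sum_add_distrib]; ring
  | some i => AddMonoidHom.mk' (fun c => c.2 i.castSucc - c.2 i.succ) fun x y => by
      simp only [Prod.snd_add, Pi.add_apply]; ring

/-- The simple roots on curve classes, with the reflection in `none` the standard Cremona
transformation of the first `r + 1` points and the other reflections the transpositions of
consecutive points. -/
def simpleRoot (r n : ℕ) : Option (Fin n) → CurveClass (n + 1)
  | none => ((r : ℤ) - 1, fun i => if i ∈ firstIndices r (n + 1) then 1 else 0)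
  | some i => (0, fun j => (if j = i.succ then 1 else 0) - if j = i.castSucc then 1 else 0)

theorem isSimplyLaced_simpleRoot (r n : ℕ) (hn : r ≤ n) :
    IsSimplyLaced (simpleCoroot r n) (simpleRoot r n) where
  self i := by
    cases i with
    | none =>
      have : (∑ j ∈ firstIndices r (n + 1), if j ∈ firstIndices r (n + 1) then (1 : ℤ) else 0)
          = r + 1 := by
        rw [Finset.sum_ite_mem, Finset.inter_self, Finset.sum_const,
          card_firstIndices (by omega)]
        simp
      simp only [simpleCoroot, simpleRoot, AddMonoidHom.mk'_apply, this]
      ring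
    | some i =>
      have h1 : i.castSucc ≠ i.succ := i.castSucc_lt_succ.ne
      simp [simpleCoroot, simpleRoot, h1, h1.symm]
  ne := by
    have key : ∀ i : Fin n,
        simpleCoroot r n none (simpleRoot r n (some i)) = 0 ∧
          simpleCoroot r n (some i) (simpleRoot r n none) = 0 ∨
        simpleCoroot r n none (simpleRoot r n (some i)) = 1 ∧
          simpleCoroot r n (some i) (simpleRoot r n none) = 1 := by
      intro i
      simp only [simpleCoroot, simpleRoot, AddMonoidHom.mk'_apply, Finset.sum_sub_distrib,
        Finset.sum_ite_eq', mem_firstIndices, Fin.val_succ, Fin.val_castSucc]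
      split_ifs <;> omega
    intro i j hij
    cases i with
    | none =>
      cases j with
      | none => exact absurd rfl hij
      | some j => exact key j
    | some i =>
      cases j with
      | none => rcases key i with h | h <;> simp [h.1, h.2]
      | some j =>
        have hij' : (i : ℕ) ≠ j := fun h => hij (congrArg some (Fin.ext h))
        simp only [simpleCoroot, simpleRoot, AddMonoidHom.mk'_apply, Fin.ext_iff, Fin.val_succ,
          Fin.val_castSucc]
        split_ifs <;> omega

theorem rootReflection_none (r n : ℕ) (c : CurveClass (n + 1)) :
    rootReflection (simpleCoroot r n) (simpleRoot r n) none c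
      = cremona r (firstIndices r (n + 1)) c := by
  refine Prod.ext ?_ (funext fun i => ?_)
  · simp [rootReflection, simpleCoroot, simpleRoot, cremona]; ring
  · by_cases hi : i ∈ firstIndices r (n + 1) <;>
      simp [rootReflection, simpleCoroot, simpleRoot, cremona, hi]

theorem rootReflection_some (r n : ℕ) (i : Fin n) (c : CurveClass (n + 1)) :
    rootReflection (simpleCoroot r n) (simpleRoot r n) (some i) c
      = permAut (Equiv.swap i.castSucc i.succ) c := by
  refine Prod.ext ?_ (funext fun j => ?_)
  · simp [rootReflection, simpleCoroot, simpleRoot, permAut_apply]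
  · have h1 : i.castSucc ≠ i.succ := i.castSucc_lt_succ.ne
    by_cases hj : j = i.castSucc
    · subst hj
      simp [rootReflection, simpleCoroot, simpleRoot, permAut_apply, h1]
    by_cases hj' : j = i.succ
    · subst hj'
      simp [rootReflection, simpleCoroot, simpleRoot, permAut_apply, h1.symm]
    · simp [rootReflection, simpleCoroot, simpleRoot, permAut_apply, hj, hj',
        Equiv.swap_apply_of_ne_of_ne hj hj']

/-- A property of curve classes is stable under the Weyl group as soon as it is stable under the
generators. -/
theorem weylGroup_induction {r s : ℕ} {P : CurveClass s → Prop}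
    (perm : ∀ (σ : Equiv.Perm (Fin s)) x, P x → P (permAut σ x))
    (crem : ∀ I : Finset (Fin s), I.card = r + 1 → ∀ x, P x → P (cremona r I x))
    {x : CurveClass s} (hx : P x) {y : CurveClass s}
    (hy : y ∈ MulAction.orbit (weylGroup r s) x) : P y := by
  obtain ⟨⟨g, hg⟩, rfl⟩ := hy
  change P (g x)
  suffices ∀ x, P x ↔ P (g x) from (this x).1 hx
  clear hx x
  induction hg using Subgroup.closure_induction with
  | mem g hg =>
    rcases hg with ⟨σ, rfl⟩ | ⟨I, hI, rfl⟩
    · refine fun x => ⟨perm σ x, fun h => ?_⟩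
      simpa [permAut_apply] using perm σ⁻¹ _ h
    · refine fun x => ⟨crem I hI x, fun h => ?_⟩
      have h' := crem I hI _ h
      rwa [show cremona r I (cremonaAut r I hI x) = x from cremona_cremona r I hI x] at h'
  | one => exact fun _ => Iff.rfl
  | mul g g' _ _ ih ih' => exact fun x => (ih' x).trans (ih (g' x))
  | inv g _ ih =>
    intro x
    have h := (ih (g⁻¹ x)).symm
    rwa [show g (g⁻¹ x) = x from g.apply_symm_apply x] at h

theorem Descends.permAut {r n : ℕ} (hn : r ≤ n) {z : CurveClass (n + 1)}
    (σ : Equiv.Perm (Fin (n + 1))) : ∀ {k : ℕ} {x : CurveClass (n + 1)},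
    Descends (simpleCoroot r n) (simpleRoot r n) k x z →
    ∃ l, Descends (simpleCoroot r n) (simpleRoot r n) l (permAut σ x) z := by
  have hσ : σ ∈ Submonoid.closure
      (Set.range fun i : Fin n => Equiv.swap i.castSucc i.succ) := by
    rw [Equiv.Perm.mclosure_swap_castSucc_succ]; trivial
  induction hσ using Submonoid.closure_induction with
  | mem τ hτ =>
    obtain ⟨i, rfl⟩ := hτ
    intro k x h
    simpa only [rootReflection_some] using
      h.rootReflection (isSimplyLaced_simpleRoot r n hn) (some i)
  | one => intro k x h; exact ⟨k, h⟩
  | mul σ τ _ _ ihσ ihτ =>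
    intro k x h
    obtain ⟨l, hl⟩ := ihσ h
    exact ihτ hl

/-- Every element of the Weyl group orbit of a dominant class descends to that class. -/
theorem exists_descends_of_mem_orbit {r n : ℕ} (hn : r ≤ n) {y z : CurveClass (n + 1)}
    (hz : ∀ i, 0 ≤ simpleCoroot r n i z)
    (hy : y ∈ MulAction.orbit (weylGroup r (n + 1)) z) :
    ∃ k, Descends (simpleCoroot r n) (simpleRoot r n) k y z := by
  refine weylGroup_induction (r := r)
    (P := fun y => ∃ k, Descends (simpleCoroot r n) (simpleRoot r n) k y z)
    (fun σ x ⟨k, hk⟩ => hk.permAut hn σ) ?_ ⟨0, .dominant hz⟩ hy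
  rintro I hI x ⟨k, h⟩
  obtain ⟨σ, hσ⟩ := exists_perm_mem_iff (I := I) (J := firstIndices r (n + 1))
    (by rw [hI, card_firstIndices (by omega)])
  obtain ⟨l, hl⟩ := h.permAut hn σ⁻¹
  obtain ⟨l, hl⟩ := hl.rootReflection (isSimplyLaced_simpleRoot r n hn) none
  rw [rootReflection_none] at hl
  obtain ⟨l, hl⟩ := hl.permAut hn σ
  rw [← cremona_permAut r σ I _ hσ,
    show permAut σ (permAut σ⁻¹ x) = x by simp [permAut_apply]] at hl
  exact ⟨l, hl⟩

/-! ### Invariants, dominant classes and termination -/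

theorem pairing_permAut (r : ℕ) {s : ℕ} (σ : Equiv.Perm (Fin s)) (x y : CurveClass s) :
    pairing r (permAut σ x) (permAut σ y) = pairing r x y := by
  simp only [pairing, permAut_apply]
  rw [Equiv.sum_comp σ fun i => x.2 i * y.2 i]

theorem quad_cremona (r : ℕ) {s : ℕ} {I : Finset (Fin s)} (hI : I.card = r + 1)
    (x : CurveClass s) : quad r (cremona r I x) = quad r x := by
  have h : ∀ T : ℤ, ∑ i, (if i ∈ I then x.2 i + T else x.2 i) ^ 2
      = ∑ i, x.2 i ^ 2 + (2 * T * ∑ i ∈ I, x.2 i + (r + 1) * T ^ 2) := by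
    intro T
    have : ∀ i, (if i ∈ I then x.2 i + T else x.2 i) ^ 2
        = x.2 i ^ 2 + if i ∈ I then 2 * T * x.2 i + T ^ 2 else 0 := fun i => by
      split_ifs <;> ring
    simp only [this, Finset.sum_add_distrib, Finset.sum_ite_mem, Finset.univ_inter,
      Finset.sum_const, hI, ← Finset.mul_sum]
    simp
  simp only [quad, cremona, h]
  ring

theorem pairing_cremona (r : ℕ) {s : ℕ} {I : Finset (Fin s)} (hI : I.card = r + 1)
    (x y : CurveClass s) : pairing r (cremona r I x) (cremona r I y) = pairing r x y := by
  have h1 := two_mul_pairing r (cremona r I x) (cremona r I y)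
  rw [← cremona_add, quad_cremona r hI, quad_cremona r hI, quad_cremona r hI,
    ← two_mul_pairing] at h1
  linarith

theorem pairing_self (r : ℕ) {s : ℕ} (x : CurveClass s) : pairing r x x = quad r x := by
  simp only [pairing, quad, sq]

theorem cremona_anticanonical (r : ℕ) {s : ℕ} {I : Finset (Fin s)} (hI : I.card = r + 1) :
    cremona r I (anticanonical r s) = anticanonical r s := by
  simp [cremona, anticanonical, hI]

/-- The degree with respect to the anticanonical curve class is invariant under the Weyl group,
as is the quadratic form. -/
theorem invariants_of_mem_orbit {r s : ℕ} {x y : CurveClass s}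
    (h : y ∈ MulAction.orbit (weylGroup r s) x) :
    pairing r y (anticanonical r s) = pairing r x (anticanonical r s) ∧
      quad r y = quad r x := by
  refine weylGroup_induction (r := r)
    (P := fun y => pairing r y (anticanonical r s) = pairing r x (anticanonical r s) ∧
      quad r y = quad r x) ?_ ?_ ⟨rfl, rfl⟩ h
  · rintro σ y ⟨h1, h2⟩
    refine ⟨?_, ?_⟩
    · rw [← h1]; exact pairing_permAut r σ y (anticanonical r s)
    · rw [← h2, ← pairing_self, pairing_permAut, pairing_self]
  · rintro I hI y ⟨h1, h2⟩
    refine ⟨?_, ?_⟩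
    · rw [← h1, ← pairing_cremona r hI y, cremona_anticanonical r hI]
    · rw [quad_cremona r hI, h2]

theorem permAut_mem_orbit {r s : ℕ} {x y : CurveClass s} (σ : Equiv.Perm (Fin s))
    (h : y ∈ MulAction.orbit (weylGroup r s) x) :
    permAut σ y ∈ MulAction.orbit (weylGroup r s) x :=
  MulAction.mem_orbit_of_mem_orbit
    (⟨permAut σ, Subgroup.subset_closure (.inl ⟨σ, rfl⟩)⟩ : weylGroup r s) h

theorem cremona_mem_orbit {r s : ℕ} {x y : CurveClass s} {I : Finset (Fin s)}
    (hI : I.card = r + 1) (h : y ∈ MulAction.orbit (weylGroup r s) x) :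
    cremona r I y ∈ MulAction.orbit (weylGroup r s) x :=
  MulAction.mem_orbit_of_mem_orbit
    (⟨cremonaAut r I hI, Subgroup.subset_closure (.inr ⟨I, hI, rfl⟩)⟩ : weylGroup r s) h

theorem sortDesc_eq_permAut {s : ℕ} (x : CurveClass s) :
    sortDesc x = permAut (Tuple.sort fun i => -x.2 i) x := rfl

theorem ReducesTo.mem_orbit {r s : ℕ} (hs : r + 1 ≤ s) {x y : CurveClass s}
    (h : ReducesTo r x y) : y ∈ MulAction.orbit (weylGroup r s) x := by
  induction h with
  | refl => exact permAut_mem_orbit _ (MulAction.mem_orbit_self x)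
  | tail _ h ih =>
    rw [h.2]
    exact permAut_mem_orbit _ (cremona_mem_orbit (card_firstIndices hs) ih)

theorem ReducesTo.antitone {r s : ℕ} {x y : CurveClass s} (h : ReducesTo r x y) :
    Antitone y.2 := by
  cases h with
  | refl => exact sortDesc_antitone x
  | tail _ h => rw [h.2]; exact sortDesc_antitone _

theorem ReducesTo.isWeylLine_iff {r s : ℕ} (hs : r + 1 ≤ s) {x y : CurveClass s}
    (h : ReducesTo r x y) : IsWeylLine r x ↔ IsWeylLine r y := by
  rw [IsWeylLine, IsWeylLine, ← MulAction.orbit_eq_iff, ← MulAction.orbit_eq_iff,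
    MulAction.orbit_eq_iff.2 (h.mem_orbit hs)]

/-- Among the sets of `r + 1` indices, the first one gives the largest sum of multiplicities of
an ordered class. -/
theorem sum_le_sum_firstIndices {r s : ℕ} (hs : r + 1 ≤ s) {m : Fin s → ℤ} (hm : Antitone m)
    {I : Finset (Fin s)} (hI : I.card = r + 1) :
    ∑ i ∈ I, m i ≤ ∑ i ∈ firstIndices r s, m i := by
  rw [← Finset.sum_sdiff_le_sum_sdiff]
  have hcard : (I \ firstIndices r s).card = (firstIndices r s \ I).card :=
    Finset.card_sdiff_comm (by rw [hI, card_firstIndices hs])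
  let l : Fin s := ⟨r, by omega⟩
  calc ∑ i ∈ I \ firstIndices r s, m i ≤ (I \ firstIndices r s).card • m l := by
        refine Finset.sum_le_card_nsmul _ _ _ fun i hi => hm ?_
        simp only [Finset.mem_sdiff, mem_firstIndices] at hi
        exact Fin.le_def.2 (show r ≤ i by omega)
    _ ≤ ∑ i ∈ firstIndices r s \ I, m i := by
        rw [hcard]
        refine Finset.card_nsmul_le_sum _ _ _ fun i hi => hm ?_
        simp only [Finset.mem_sdiff, mem_firstIndices] at hi
        exact Fin.le_def.2 (show (i : ℕ) ≤ r by omega)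

theorem isCremonaReduced_iff_of_antitone {r s : ℕ} (hs : r + 1 ≤ s) {x : CurveClass s}
    (hx : Antitone x.2) : IsCremonaReduced r x ↔ ∑ i ∈ firstIndices r s, x.2 i ≤ x.1 :=
  ⟨fun h => h _ (card_firstIndices hs), fun h _ hI =>
    (sum_le_sum_firstIndices hs hx hI).trans h⟩

theorem isCremonaReduced_permAut {r s : ℕ} {x : CurveClass s} (σ : Equiv.Perm (Fin s))
    (h : IsCremonaReduced r x) : IsCremonaReduced r (permAut σ x) := by
  intro I hI
  have := h (I.map σ.toEmbedding) (by rw [Finset.card_map, hI])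
  simpa [permAut_apply] using this

theorem simpleCoroot_nonneg {r n : ℕ} (hn : r ≤ n) {x : CurveClass (n + 1)}
    (h1 : Antitone x.2) (h2 : IsCremonaReduced r x) (i : Option (Fin n)) :
    0 ≤ simpleCoroot r n i x := by
  cases i with
  | none => exact sub_nonneg.2 (h2 _ (card_firstIndices (by omega)))
  | some i => exact sub_nonneg.2 (h1 i.castSucc_lt_succ.le)

/-- A Weyl group orbit contains at most one ordered Cremona reduced class. -/
theorem eq_of_mem_orbit_of_isCremonaReduced {r s : ℕ} (hs : r + 1 ≤ s) {x y : CurveClass s}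
    (hx : Antitone x.2) (hx' : IsCremonaReduced r x)
    (hy : Antitone y.2) (hy' : IsCremonaReduced r y)
    (h : y ∈ MulAction.orbit (weylGroup r s) x) : y = x := by
  obtain ⟨n, rfl⟩ : ∃ n, s = n + 1 := ⟨s - 1, by omega⟩
  obtain ⟨k, hk⟩ := exists_descends_of_mem_orbit (by omega)
    (simpleCoroot_nonneg (by omega) hx hx') h
  exact hk.eq_of_dominant (simpleCoroot_nonneg (by omega) hy hy')

/-- An ordered Cremona reduced class has the least degree in its Weyl group orbit. -/
theorem degree_le_of_mem_orbit {r s : ℕ} (hr : 1 ≤ r) (hs : r + 1 ≤ s) {x y : CurveClass s}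
    (hx : Antitone x.2) (hx' : IsCremonaReduced r x)
    (h : y ∈ MulAction.orbit (weylGroup r s) x) : x.1 ≤ y.1 := by
  obtain ⟨n, rfl⟩ : ∃ n, s = n + 1 := ⟨s - 1, by omega⟩
  obtain ⟨k, hk⟩ := exists_descends_of_mem_orbit (by omega)
    (simpleCoroot_nonneg (by omega) hx hx') h
  clear h hx hx'
  induction hk with
  | dominant => exact le_rfl
  | step i hi _ ih =>
    refine ih.trans ?_
    cases i with
    | none =>
      simp only [rootReflection, simpleRoot, Prod.fst_add, Prod.smul_fst, smul_eq_mul]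
      have : (1 : ℤ) ≤ r := by exact_mod_cast hr
      nlinarith
    | some i => simp [rootReflection, simpleRoot]

theorem ReductionStep.degree_lt {r s : ℕ} (hr : 2 ≤ r) (hs : r + 1 ≤ s) {x y : CurveClass s}
    (hx : Antitone x.2) (h : ReductionStep r x y) : y.1 < x.1 := by
  obtain ⟨h, rfl⟩ := h
  rw [isCremonaReduced_iff_of_antitone hs hx, not_le] at h
  simp only [sortDesc, cremona]
  have : (2 : ℤ) ≤ r := by exact_mod_cast hr
  nlinarith

/-- The reduction algorithm stops if the degree is bounded below on the Weyl group orbit. -/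
theorem exists_endsAt_of_degree_ge {r s : ℕ} (hr : 2 ≤ r) (hs : r + 1 ≤ s) (c : CurveClass s)
    (B : ℤ) (hB : ∀ y ∈ MulAction.orbit (weylGroup r s) c, B ≤ y.1) : ∃ R, EndsAt r c R := by
  suffices ∀ (k : ℕ) (x : CurveClass s), ReducesTo r c x → x.1 - B ≤ k → ∃ R, EndsAt r c R from
    this _ _ .refl (Int.self_le_toNat _)
  intro k
  induction k with
  | zero =>
    intro x hx hk
    refine ⟨x, hx, by_contra fun h => ?_⟩
    have h1 : ReductionStep r x _ := ⟨h, rfl⟩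
    have h2 := hB _ (ReducesTo.mem_orbit hs (hx.tail h1))
    have h3 := h1.degree_lt hr hs hx.antitone
    push_cast at hk
    linarith
  | succ k ih =>
    intro x hx hk
    by_cases h : IsCremonaReduced r x
    · exact ⟨x, hx, h⟩
    have h1 : ReductionStep r x _ := ⟨h, rfl⟩
    refine ih _ (hx.tail h1) ?_
    have h3 := h1.degree_lt hr hs hx.antitone
    push_cast at hk
    omega

/-- The Cauchy–Schwarz inequality for the multiplicities, in terms of the two invariants. -/
theorem cauchySchwarz_invariants {r s : ℕ} (hr : 1 ≤ r) (x : CurveClass s) :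
    (((r : ℤ) + 1) * x.1 - pairing r x (anticanonical r s)) ^ 2
      ≤ s * ((r : ℤ) - 1) * (x.1 ^ 2 - quad r x) := by
  have h := sq_sum_le_card_mul_sum_sq (s := Finset.univ) (f := x.2)
  rw [Finset.card_univ, Fintype.card_fin] at h
  have h1 : (1 : ℤ) ≤ r := by exact_mod_cast hr
  have h2 := mul_le_mul_of_nonneg_left h (sq_nonneg ((r : ℤ) - 1))
  simp only [pairing, quad, anticanonical, mul_one]
  linarith

theorem exists_endsAt {r s : ℕ} (hr : 2 ≤ r) (hs : r + 1 ≤ s)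
    (hrs : (s : ℤ) * ((r : ℤ) - 1) < ((r : ℤ) + 1) ^ 2) (c : CurveClass s) :
    ∃ R, EndsAt r c R := by
  set f := pairing r c (anticanonical r s) with hf
  set b := ((r : ℤ) + 1) * f with hb
  set e := b ^ 2 - (f ^ 2 + s * ((r : ℤ) - 1) * quad r c) with he
  refine exists_endsAt_of_degree_ge hr hs c (b - |e|) fun y hy => ?_
  obtain ⟨h1, h2⟩ := invariants_of_mem_orbit hy
  have h := cauchySchwarz_invariants (by omega : 1 ≤ r) y
  rw [h1, h2, ← hf] at h
  -- The leading coefficient of this quadratic inequality for the degree is at least `1`.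
  have h3 : (y.1 - b) ^ 2 ≤ e := by
    have : y.1 ^ 2 * 1 ≤ y.1 ^ 2 * (((r : ℤ) + 1) ^ 2 - s * ((r : ℤ) - 1)) :=
      mul_le_mul_of_nonneg_left (by linarith) (sq_nonneg _)
    rw [he, hb]
    linarith
  have h4 := Int.le_self_sq (b - y.1)
  have h5 := le_abs_self e
  linarith [sub_sq_comm y.1 b]

/-! ### The table of reduced classes -/

/-- The ordered class of degree `d` whose first `b` multiplicities are `a + 1` and whose other
multiplicities are `a`. -/
def levelClass (s : ℕ) (d a : ℤ) (b : ℕ) : CurveClass s :=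
  (d, fun i => a + if (i : ℕ) < b then 1 else 0)

theorem levelClass_antitone (s : ℕ) (d a : ℤ) (b : ℕ) : Antitone (levelClass s d a b).2 := by
  intro i j hij
  have : (i : ℕ) ≤ j := hij
  simp only [levelClass]
  split_ifs <;> omega

theorem sum_univ_levelClass (s : ℕ) (d a : ℤ) (b : ℕ) :
    ∑ i, (levelClass s d a b).2 i = s * a + min b s := by
  simp only [levelClass, Finset.sum_add_distrib, Finset.sum_boole, Fin.card_filter_val_lt]
  simp [min_comm]

theorem sum_firstIndices_levelClass {r s : ℕ} (hs : r + 1 ≤ s) (d a : ℤ) (b : ℕ) :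
    ∑ i ∈ firstIndices r s, (levelClass s d a b).2 i = (r + 1) * a + min b (r + 1) := by
  have h : (firstIndices r s).filter (fun i : Fin s => (i : ℕ) < b)
      = Finset.univ.filter fun i : Fin s => (i : ℕ) < min b (r + 1) := by
    ext i; simp [mem_firstIndices, and_comm]
  simp only [levelClass, Finset.sum_add_distrib, Finset.sum_boole, h, Fin.card_filter_val_lt,
    Finset.sum_const, card_firstIndices hs]
  rw [min_eq_right (by omega : min b (r + 1) ≤ s)]
  simp

theorem isCremonaReduced_levelClass {r s : ℕ} (hs : r + 1 ≤ s) {d a : ℤ} {b : ℕ}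
    (h : (r + 1) * a + min (b : ℤ) (r + 1) ≤ d) : IsCremonaReduced r (levelClass s d a b) := by
  rw [isCremonaReduced_iff_of_antitone hs (levelClass_antitone s d a b),
    sum_firstIndices_levelClass hs]
  exact_mod_cast h

theorem lineClass_eq_levelClass (s : ℕ) : lineClass s = levelClass s 1 0 2 := by
  simp [lineClass, levelClass]

theorem isWeylLine_lineClass (r s : ℕ) : IsWeylLine r (lineClass s) :=
  MulAction.mem_orbit_self _

theorem pairing_lineClass {r s : ℕ} (hs : 2 ≤ s) :
    pairing r (lineClass s) (anticanonical r s) = 3 - r := by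
  have h := sum_univ_levelClass s 1 0 2
  rw [← lineClass_eq_levelClass, min_eq_left (by exact_mod_cast hs)] at h
  simp only [pairing, anticanonical, mul_one, h]
  simp [lineClass]
  ring

theorem quad_lineClass {r s : ℕ} (hs : 2 ≤ s) : quad r (lineClass s) = 3 - 2 * r := by
  have h := sum_univ_levelClass s 1 0 2
  rw [← lineClass_eq_levelClass, min_eq_left (by exact_mod_cast hs)] at h
  have h' : ∀ i, (lineClass s).2 i ^ 2 = (lineClass s).2 i := by
    intro i; simp only [lineClass]; split_ifs <;> rfl
  simp only [quad, h', h]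
  simp [lineClass]
  ring

theorem IsWeylLine.pairing_eq {r s : ℕ} (hs : 2 ≤ s) {c : CurveClass s} (h : IsWeylLine r c) :
    pairing r c (anticanonical r s) = 3 - r :=
  (invariants_of_mem_orbit h).1.trans (pairing_lineClass hs)

theorem IsWeylLine.quad_eq {r s : ℕ} (hs : 2 ≤ s) {c : CurveClass s} (h : IsWeylLine r c) :
    quad r c = 3 - 2 * r :=
  (invariants_of_mem_orbit h).2.trans (quad_lineClass hs)

theorem card_filter_ne_eq {s : ℕ} (p : Fin s) :
    (Finset.univ.filter fun i => i ≠ p).card = s - 1 := by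
  rw [Finset.filter_ne', Finset.card_erase_of_mem (Finset.mem_univ p), Finset.card_fin]

theorem isWeylLine_levelClass_of_eq_two {s : ℕ} (hs : 3 ≤ s) :
    IsWeylLine 2 (levelClass s 0 (-1) (s - 1)) := by
  have h := permAut_mem_orbit (Equiv.swap ⟨2, by omega⟩ ⟨s - 1, by omega⟩)
    (cremona_mem_orbit (card_firstIndices hs) (isWeylLine_lineClass 2 s))
  suffices e : permAut (Equiv.swap ⟨2, by omega⟩ ⟨s - 1, by omega⟩)
      (cremona 2 (firstIndices 2 s) (lineClass s)) = levelClass s 0 (-1) (s - 1) from e ▸ h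
  have hsum := sum_firstIndices_levelClass hs 1 0 2
  simp only [lineClass_eq_levelClass, cremona, hsum, permAut_apply, mem_firstIndices]
  refine Prod.ext (by simp [levelClass]) (funext fun i => ?_)
  have hi := i.2
  simp only [levelClass, Equiv.swap_apply_def, Fin.ext_iff, apply_ite Fin.val]
  push_cast
  split_ifs <;> omega

theorem isWeylLine_levelClass_of_eq_add_one {r s : ℕ} (hr : 2 ≤ r) (hs : s = r + 1) :
    IsWeylLine r (levelClass s (2 - r) (-1) 2) := by
  have h := cremona_mem_orbit (I := Finset.univ) (by simp [hs]) (isWeylLine_lineClass r s)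
  suffices e : cremona r Finset.univ (lineClass s) = levelClass s (2 - r) (-1) 2 from e ▸ h
  simp only [lineClass_eq_levelClass, cremona, sum_univ_levelClass, min_eq_left (by omega : 2 ≤ s)]
  refine Prod.ext ?_ (funext fun i => ?_)
  · simp [levelClass]; ring
  · simp [levelClass]; ring

theorem isWeylLine_levelClass_of_eq_add_two {r s : ℕ} (hr : 2 ≤ r) (hs : s = r + 2) :
    IsWeylLine r (levelClass s (2 - r) (-1) 3) := by
  have h := cremona_mem_orbit (I := Finset.univ.filter (· ≠ ⟨2, by omega⟩))
    (by rw [card_filter_ne_eq]; omega) (isWeylLine_lineClass r s)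
  have hsum := Finset.sum_filter_add_sum_filter_not Finset.univ
    (fun i : Fin s => i ≠ ⟨2, by omega⟩) (lineClass s).2
  rw [lineClass_eq_levelClass] at hsum
  rw [sum_univ_levelClass, min_eq_left (by omega : 2 ≤ s)] at hsum
  simp only [not_not, Finset.filter_eq', Finset.mem_univ, if_true, Finset.sum_singleton] at hsum
  have hsum' : ∑ i with i ≠ (⟨2, by omega⟩ : Fin s), (levelClass s 1 0 2).2 i = 2 := by
    simpa [levelClass] using hsum
  suffices e : cremona r (Finset.univ.filter (· ≠ ⟨2, by omega⟩)) (lineClass s)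
      = levelClass s (2 - r) (-1) 3 from e ▸ h
  simp only [lineClass_eq_levelClass, cremona, hsum']
  refine Prod.ext ?_ (funext fun i => ?_)
  · simp [levelClass]; ring
  · simp only [levelClass, Finset.mem_filter, Finset.mem_univ, true_and, Fin.ext_iff, ne_eq]
    split_ifs <;> omega

/-- For `s = r + 3`, the standard Cremona transformation that leaves out two points of lower
multiplicity lowers all multiplicities by `1` and then raises them at these two points by `1`. -/
theorem isWeylLine_levelClass_of_eq_add_three {r s : ℕ} (hs : s = r + 3) (j : ℕ)
    (hj : 2 + 2 * j ≤ s) :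
    IsWeylLine r (levelClass s (1 - ((r : ℤ) - 1) * j) (-j) (2 + 2 * j)) := by
  induction j with
  | zero =>
    have := isWeylLine_lineClass r s
    rw [lineClass_eq_levelClass] at this
    simpa using this
  | succ j ih =>
    let p : Fin s := ⟨2 + 2 * j, by omega⟩
    let q : Fin s := ⟨3 + 2 * j, by omega⟩
    have hpq : p ≠ q := by simp [p, q, Fin.ext_iff]
    have hI : (Finset.univ \ {p, q}).card = r + 1 := by
      rw [Finset.card_sdiff_of_subset (Finset.subset_univ _), Finset.card_pair hpq,
        Finset.card_fin]
      omega
    have h := cremona_mem_orbit hI (ih (by omega))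
    have hsum := Finset.sum_sdiff (Finset.subset_univ {p, q})
      (f := (levelClass s (1 - ((r : ℤ) - 1) * j) (-j) (2 + 2 * j)).2)
    rw [Finset.sum_pair hpq, sum_univ_levelClass,
      min_eq_left (by omega : 2 + 2 * j ≤ s)] at hsum
    have hsum' : ∑ i ∈ Finset.univ \ {p, q},
        (levelClass s (1 - ((r : ℤ) - 1) * j) (-j) (2 + 2 * j)).2 i = 2 - ((r : ℤ) - 1) * j := by
      have hp : (levelClass s (1 - ((r : ℤ) - 1) * j) (-j) (2 + 2 * j)).2 p = -j := by
        simp [levelClass, p]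
      have hq : (levelClass s (1 - ((r : ℤ) - 1) * j) (-j) (2 + 2 * j)).2 q = -j := by
        simp [levelClass, q]
      have hs' : (s : ℤ) = r + 3 := by exact_mod_cast hs
      rw [hp, hq, hs'] at hsum
      push_cast at hsum
      linarith
    suffices e : cremona r (Finset.univ \ {p, q})
        (levelClass s (1 - ((r : ℤ) - 1) * j) (-j) (2 + 2 * j))
        = levelClass s (1 - ((r : ℤ) - 1) * (j + 1 : ℕ)) (-(j + 1 : ℕ)) (2 + 2 * (j + 1)) from
      e ▸ h
    simp only [cremona, hsum']
    refine Prod.ext ?_ (funext fun i => ?_)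
    · simp only [levelClass]; push_cast; ring
    · simp only [levelClass, Finset.mem_sdiff, Finset.mem_univ, true_and, Finset.mem_insert,
        Finset.mem_singleton, Fin.ext_iff, p, q]
      push_cast
      split_ifs <;> omega

theorem isWeylLine_levelClass_three_seven : IsWeylLine 3 (levelClass 7 (-3) (-1) 1) := by
  suffices e : permAut (Equiv.swap 0 6) (cremona 3 {0, 1, 4, 5} (cremona 3 {0, 1, 2, 3}
      (lineClass 7))) = levelClass 7 (-3) (-1) 1 from
    e ▸ permAut_mem_orbit _ (cremona_mem_orbit rfl (cremona_mem_orbit rfl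
      (isWeylLine_lineClass 3 7)))
  decide

theorem isWeylLine_levelClass_four_eight : IsWeylLine 4 (levelClass 8 (-14) (-3) 1) := by
  suffices e : permAut (Equiv.swap 0 7) (cremona 4 {2, 3, 4, 5, 6} (cremona 4 {0, 1, 2, 3, 4}
      (cremona 4 {0, 1, 5, 6, 7} (cremona 4 {0, 1, 2, 3, 4} (lineClass 8)))))
      = levelClass 8 (-14) (-3) 1 from
    e ▸ permAut_mem_orbit _ (cremona_mem_orbit rfl (cremona_mem_orbit rfl
      (cremona_mem_orbit rfl (cremona_mem_orbit rfl (isWeylLine_lineClass 4 8)))))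
  decide

/-- The pairs `(r, s)` with `r ≥ 3` and a finite Weyl group. -/
theorem eq_of_mul_lt_sq {r s : ℕ} (hr : 3 ≤ r) (hs : r + 1 ≤ s)
    (hrs : (s : ℤ) * ((r : ℤ) - 1) < ((r : ℤ) + 1) ^ 2) :
    s = r + 1 ∨ s = r + 2 ∨ s = r + 3 ∨ r = 3 ∧ s = 7 ∨ r = 4 ∧ s = 8 := by
  by_cases h : s ≤ r + 3
  · omega
  obtain ⟨k, rfl⟩ : ∃ k, s = r + 4 + k := ⟨s - (r + 4), by omega⟩
  have hr' : (3 : ℤ) ≤ r := by exact_mod_cast hr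
  push_cast at hrs
  have h5 : (r : ℤ) < 5 := by
    nlinarith [mul_nonneg (Int.natCast_nonneg k) (by linarith : (0 : ℤ) ≤ r - 1)]
  have h5' : r < 5 := by exact_mod_cast h5
  interval_cases r <;> omega

/-- The table lists, in each case, the ordered Cremona reduced class in the orbit of the line. -/
theorem reducedClass_spec {r s : ℕ} (hr : 2 ≤ r) (hs : r + 1 ≤ s)
    (hrs : r = 2 ∨ (s : ℤ) * ((r : ℤ) - 1) < ((r : ℤ) + 1) ^ 2) :
    IsWeylLine r (reducedClass r s) ∧ Antitone (reducedClass r s).2 ∧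
      IsCremonaReduced r (reducedClass r s) ∧ (reducedClass r s).1 ≤ 0 := by
  suffices ∃ d a b, reducedClass r s = levelClass s d a b ∧ IsWeylLine r (levelClass s d a b) ∧
      (r + 1) * a + min (b : ℤ) (r + 1) ≤ d ∧ d ≤ 0 by
    obtain ⟨d, a, b, h, h1, h2, h3⟩ := this
    rw [h]
    exact ⟨h1, levelClass_antitone s d a b, isCremonaReduced_levelClass hs h2, h3⟩
  by_cases h2 : r = 2
  · subst h2
    refine ⟨0, -1, s - 1, ?_, isWeylLine_levelClass_of_eq_two hs, ?_, le_rfl⟩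
    · simp only [reducedClass, levelClass, if_true]
      refine Prod.ext rfl (funext fun i => ?_)
      have := i.2
      simp only
      split_ifs <;> omega
    · push_cast; omega
  have hr3 : 3 ≤ r := by omega
  rcases eq_of_mul_lt_sq hr3 hs (hrs.resolve_left h2) with h | h | h | ⟨rfl, rfl⟩ | ⟨rfl, rfl⟩
  · refine ⟨2 - r, -1, 2, ?_, isWeylLine_levelClass_of_eq_add_one hr h, ?_, ?_⟩
    · rw [reducedClass, if_neg h2, if_pos h]
      refine Prod.ext rfl (funext fun i => ?_)
      simp only [levelClass]
      split_ifs <;> omega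
    · push_cast; omega
    · omega
  · refine ⟨2 - r, -1, 3, ?_, isWeylLine_levelClass_of_eq_add_two hr h, ?_, ?_⟩
    · rw [reducedClass, if_neg h2, if_neg (by omega), if_pos h]
      refine Prod.ext rfl (funext fun i => ?_)
      simp only [levelClass]
      split_ifs <;> omega
    · push_cast; omega
    · omega
  · rcases Nat.even_or_odd' r with ⟨k, hk | hk⟩
    · refine ⟨_, _, _, ?_, isWeylLine_levelClass_of_eq_add_three h k (by omega), ?_, ?_⟩
      · have hk' : r / 2 = k := by omega
        have he : Even r := ⟨k, by omega⟩
        rw [reducedClass, if_neg h2, if_neg (by omega), if_neg (by omega), if_pos h, hk']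
        simp only [if_pos he]
        refine Prod.ext ?_ (funext fun i => ?_)
        · simp only [levelClass, hk]; push_cast; ring
        · have := i.2
          simp only [levelClass]
          split_ifs <;> omega
      · subst hk; push_cast; rw [min_eq_right (by omega)]; nlinarith
      · subst hk; push_cast
        have : (2 : ℤ) ≤ k := by omega
        nlinarith
    · refine ⟨_, _, _, ?_, isWeylLine_levelClass_of_eq_add_three h (k + 1) (by omega), ?_, ?_⟩
      · have hk' : r / 2 = k := by omega
        have he : ¬ Even r := Nat.not_even_iff_odd.2 ⟨k, by omega⟩
        rw [reducedClass, if_neg h2, if_neg (by omega), if_neg (by omega), if_pos h, hk']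
        simp only [if_neg he]
        refine Prod.ext ?_ (funext fun i => ?_)
        · simp only [levelClass, hk]; push_cast; ring
        · have := i.2
          simp only [levelClass]
          push_cast
          split_ifs <;> omega
      · subst hk; push_cast; rw [min_eq_right (by omega)]; nlinarith
      · subst hk; push_cast
        have : (1 : ℤ) ≤ k := by omega
        nlinarith
  · refine ⟨-3, -1, 1, by decide, isWeylLine_levelClass_three_seven, by norm_num, by norm_num⟩
  · refine ⟨-14, -3, 1, by decide, isWeylLine_levelClass_four_eight, by norm_num, by norm_num⟩

/-! ### Multiplicities of Weyl lines -/

theorem pairing_anticanonical (r : ℕ) {s : ℕ} (x : CurveClass s) :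
    pairing r x (anticanonical r s) = (r + 1) * x.1 - (r - 1) * ∑ i, x.2 i := by
  simp [pairing, anticanonical, mul_comm]

/-- For `r = 2` the dominant class is `e_s`, whose last multiplicity is `-1`. A simple root whose
coroot is positive on `e_s` has last multiplicity `1`, and no simple root has a negative one: so
the last multiplicity jumps to `0` in the first step up from `e_s` and does not drop afterwards. -/
theorem IsWeylLine.last_nonneg {n : ℕ} (hn : 2 ≤ n) {y : CurveClass (n + 1)}
    (hy : IsWeylLine 2 y) : y = levelClass (n + 1) 0 (-1) n ∨ 0 ≤ y.2 (Fin.last n) := by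
  have hR : IsWeylLine 2 (levelClass (n + 1) 0 (-1) n) :=
    isWeylLine_levelClass_of_eq_two (by omega)
  have hred : IsCremonaReduced 2 (levelClass (n + 1) 0 (-1) n) :=
    isCremonaReduced_levelClass (by omega) (by push_cast; omega)
  rw [IsWeylLine, ← MulAction.orbit_eq_iff.2 hR] at hy
  obtain ⟨k, hk⟩ := exists_descends_of_mem_orbit hn
    (simpleCoroot_nonneg hn (levelClass_antitone _ _ _ _) hred) hy
  clear hy hR hred
  have hroot : ∀ i, 0 ≤ (simpleRoot 2 n i).2 (Fin.last n) := by
    intro i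
    cases i with
    | none => simp only [simpleRoot]; split_ifs <;> simp
    | some i =>
      have := i.2
      simp only [simpleRoot, Fin.ext_iff, Fin.val_last, Fin.val_castSucc, Fin.val_succ]
      split_ifs <;> omega
  generalize hz : levelClass (n + 1) 0 (-1) n = z at hk
  induction hk with
  | dominant => exact .inl rfl
  | @step k x z i hi hk ih =>
    right
    have hlast : (rootReflection (simpleCoroot 2 n) (simpleRoot 2 n) i x).2 (Fin.last n)
        = x.2 (Fin.last n)
          + simpleCoroot 2 n i x * (simpleRoot 2 n i).2 (Fin.last n) := by
      simp [rootReflection]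
    rcases ih hz with h | h
    · have hpos : 0 < simpleCoroot 2 n i z := by
        rw [← h, coroot_rootReflection, (isSimplyLaced_simpleRoot 2 n hn).self]
        linarith
      have h1 : 1 ≤ (simpleRoot 2 n i).2 (Fin.last n) := by
        rw [← hz] at hpos
        cases i with
        | none =>
          simp only [simpleCoroot, AddMonoidHom.mk'_apply,
            sum_firstIndices_levelClass (by omega : 2 + 1 ≤ n + 1)] at hpos
          simp only [levelClass] at hpos
          have : n < 3 := by push_cast at hpos; omega
          simp [simpleRoot, mem_firstIndices, this]
        | some i =>
          have := i.2
          simp only [simpleCoroot, AddMonoidHom.mk'_apply, levelClass, Fin.val_castSucc,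
            Fin.val_succ] at hpos
          simp only [simpleRoot, Fin.ext_iff, Fin.val_last, Fin.val_castSucc, Fin.val_succ]
          split_ifs at hpos ⊢ <;> omega
      have h2 : z.2 (Fin.last n) = -1 := by simp [← hz, levelClass]
      rw [h, h2] at hlast
      nlinarith
    · nlinarith [hroot i]

/-- On the blowup of the plane, the only Weyl lines with a negative multiplicity are
`e_1, …, e_s`. -/
theorem IsWeylLine.multiplicity_nonneg {s : ℕ} (hs : 3 ≤ s) {y : CurveClass s}
    (hy : IsWeylLine 2 y) (hd : y.1 ≠ 0) (j : Fin s) : 0 ≤ y.2 j := by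
  obtain ⟨n, rfl⟩ : ∃ n, s = n + 1 := ⟨s - 1, by omega⟩
  rcases IsWeylLine.last_nonneg (by omega)
    (permAut_mem_orbit (Equiv.swap j (Fin.last n)) hy) with h | h
  · exact absurd (congrArg Prod.fst h) hd
  · simpa [permAut_apply] using h

/-- For `s ≤ r + 3` the class of the line is minuscule: all roots, which are the differences
`e_i - e_j` and the classes `± ((r - 1) h - ∑ i ∈ I, e_i)`, pair with it to `-1`, `0` or `1`. -/
theorem IsWeylLine.minuscule {r s : ℕ} (hs : s ≤ r + 3) {y : CurveClass s}
    (hy : IsWeylLine r y) :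
    (∀ i j, |y.2 i - y.2 j| ≤ 1) ∧
      ∀ I : Finset (Fin s), I.card = r + 1 → |y.1 - ∑ i ∈ I, y.2 i| ≤ 1 := by
  refine weylGroup_induction (r := r) (P := fun y => (∀ i j, |y.2 i - y.2 j| ≤ 1) ∧
      ∀ I : Finset (Fin s), I.card = r + 1 → |y.1 - ∑ i ∈ I, y.2 i| ≤ 1) ?_ ?_ ⟨?_, ?_⟩ hy
  · rintro σ x ⟨h1, h2⟩
    refine ⟨fun i j => h1 _ _, fun I hI => ?_⟩
    simpa [permAut_apply] using h2 (I.map σ.toEmbedding) (by rw [Finset.card_map, hI])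
  · rintro I hI x ⟨h1, h2⟩
    have hmix : ∀ a b, a ∈ I → b ∉ I → |x.2 a - x.2 b + (x.1 - ∑ i ∈ I, x.2 i)| ≤ 1 := by
      intro a b ha hb
      have hb' : b ∉ I.erase a := fun h => hb (Finset.mem_of_mem_erase h)
      have h := h2 (insert b (I.erase a)) (by
        rw [Finset.card_insert_of_notMem hb', Finset.card_erase_add_one ha, hI])
      rw [Finset.sum_insert hb', Finset.sum_erase_eq_sub ha] at h
      rw [show x.2 a - x.2 b + (x.1 - ∑ i ∈ I, x.2 i)
        = x.1 - (x.2 b + (∑ i ∈ I, x.2 i - x.2 a)) by ring]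
      exact h
    refine ⟨fun i j => ?_, fun J hJ => ?_⟩
    · simp only [cremona]
      split_ifs with hi hj hj
      · simpa using h1 i j
      · convert hmix i j hi hj using 2; ring
      · rw [abs_sub_comm]
        convert hmix j i hj hi using 2; ring
      · exact h1 i j
    · have hsum : ∑ i ∈ J, (cremona r I x).2 i
          = ∑ i ∈ J, x.2 i + (J ∩ I).card * (x.1 - ∑ i ∈ I, x.2 i) := by
        have : ∀ i, (cremona r I x).2 i
            = x.2 i + if i ∈ I then x.1 - ∑ i ∈ I, x.2 i else 0 := by
          intro i; simp only [cremona]; split_ifs <;> simp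
        simp only [this, Finset.sum_add_distrib, Finset.sum_ite_mem, Finset.sum_const,
          nsmul_eq_mul]
      have hd : (cremona r I x).1 = x.1 + (r - 1) * (x.1 - ∑ i ∈ I, x.2 i) := rfl
      rw [hsum, hd]
      have hunion := Finset.card_union_add_card_inter J I
      have hle := Finset.card_le_univ (J ∪ I)
      rw [Fintype.card_fin] at hle
      have hJI := Finset.card_sdiff_add_card_inter J I
      have hIJ := Finset.card_sdiff_add_card_inter I J
      rw [Finset.inter_comm] at hIJ
      obtain h | h | h : (J ∩ I).card = r + 1 ∨ (J ∩ I).card = r ∨ (J ∩ I).card + 1 = r := by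
        omega
      · have hJ' : J = I := by
          rw [← Finset.eq_of_subset_of_card_le (Finset.inter_subset_left (s₁ := J) (s₂ := I))
            (by omega)]
          exact Finset.eq_of_subset_of_card_le Finset.inter_subset_right (by omega)
        rw [h, hJ', ← abs_neg]
        convert h2 I hI using 2
        push_cast; ring
      · obtain ⟨b, hb⟩ := Finset.card_eq_one.1 (by omega : (J \ I).card = 1)
        obtain ⟨a, ha⟩ := Finset.card_eq_one.1 (by omega : (I \ J).card = 1)
        have e := Finset.sum_sdiff_sub_sum_sdiff (s₁ := J) (s₂ := I) (f := x.2)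
        rw [hb, ha, Finset.sum_singleton, Finset.sum_singleton] at e
        rw [h]
        convert h1 a b using 2
        linarith
      · have h' : ((J ∩ I).card : ℤ) = r - 1 := by omega
        rw [h']
        convert h2 J hJ using 2
        ring
  · intro i j
    simp only [lineClass]
    split_ifs <;> simp
  · intro I hI
    have h0 : 0 ≤ ∑ i ∈ I, (lineClass s).2 i := Finset.sum_nonneg fun i _ => by
      simp only [lineClass]; split_ifs <;> simp
    have h1 : ∑ i ∈ I, (lineClass s).2 i ≤ ∑ i, (lineClass s).2 i :=
      Finset.sum_le_sum_of_subset_of_nonneg (Finset.subset_univ _) fun i _ _ => by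
        simp only [lineClass]; split_ifs <;> simp
    rw [lineClass_eq_levelClass, sum_univ_levelClass, ← lineClass_eq_levelClass] at h1
    have h2 : ((min 2 s : ℕ) : ℤ) ≤ 2 := by omega
    rw [abs_le]
    constructor <;> simp only [lineClass] at h0 h1 ⊢ <;> linarith

theorem quad_add (r : ℕ) {s : ℕ} (x y : CurveClass s) :
    quad r (x + y) = quad r x + quad r y + 2 * pairing r x y := by
  linarith [two_mul_pairing r x y]

theorem pairing_add_left (r : ℕ) {s : ℕ} (x y z : CurveClass s) :
    pairing r (x + y) z = pairing r x z + pairing r y z := by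
  simp only [pairing, Prod.fst_add, Prod.snd_add, Pi.add_apply, add_mul, Finset.sum_add_distrib]
  ring

/-- The negative of the root that defines the Cremona transformation `φ_I`. -/
def negRoot (r : ℕ) {s : ℕ} (I : Finset (Fin s)) : CurveClass s :=
  (1 - r, fun i => if i ∈ I then -1 else 0)

theorem pairing_negRoot (r : ℕ) {s : ℕ} (I : Finset (Fin s)) (x : CurveClass s) :
    pairing r x (negRoot r I) = -((r - 1) * (x.1 - ∑ i ∈ I, x.2 i)) := by
  simp only [pairing, negRoot, mul_ite, mul_neg, mul_one, mul_zero, Finset.sum_ite_mem,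
    Finset.univ_inter, Finset.sum_neg_distrib]
  ring

theorem quad_negRoot (r : ℕ) {s : ℕ} {I : Finset (Fin s)} (hI : I.card = r + 1) :
    quad r (negRoot r I) = -(2 * (r - 1)) := by
  rw [← pairing_self, pairing_negRoot]
  simp [negRoot, hI]
  ring

theorem pairing_negRoot_anticanonical (r : ℕ) {s : ℕ} {I : Finset (Fin s)}
    (hI : I.card = r + 1) : pairing r (negRoot r I) (anticanonical r s) = 0 := by
  simp [pairing_anticanonical, negRoot, Finset.sum_ite_mem, hI]
  ring

/-- A Weyl line of positive degree in a space of dimension at least `3` pairs to at least `-1`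
with the roots of the Cremona transformations. In the two exceptional cases this is the
Cauchy–Schwarz inequality on the negative definite orthogonal complement of `F`. -/
theorem IsWeylLine.neg_one_le {r s : ℕ} (hr : 3 ≤ r) (hs : r + 1 ≤ s)
    (hrs : (s : ℤ) * ((r : ℤ) - 1) < ((r : ℤ) + 1) ^ 2) {x : CurveClass s}
    (hx : IsWeylLine r x) (hd : 0 < x.1) {I : Finset (Fin s)} (hI : I.card = r + 1) :
    -1 ≤ x.1 - ∑ i ∈ I, x.2 i := by
  rcases (by have := eq_of_mul_lt_sq hr hs hrs; omega :
    s ≤ r + 3 ∨ (r = 3 ∧ s = 7) ∨ (r = 4 ∧ s = 8)) with h | ⟨rfl, rfl⟩ | ⟨rfl, rfl⟩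
  · exact (abs_le.1 ((hx.minuscule h).2 I hI)).1
  · by_contra! ht
    have hq := hx.quad_eq (by norm_num)
    have hf := hx.pairing_eq (by norm_num)
    have h1 := cauchySchwarz_invariants (r := 3) (by norm_num) (x + negRoot 3 I)
    rw [quad_add, pairing_add_left, pairing_negRoot_anticanonical 3 hI, quad_negRoot 3 hI,
      pairing_negRoot, hq, hf] at h1
    push_cast at h1
    nlinarith [sq_nonneg (x + negRoot 3 I).1]
  · by_contra! ht
    have hq := hx.quad_eq (by norm_num)
    have hf := hx.pairing_eq (by norm_num)
    have hFq : quad 4 (anticanonical 4 8) = 1 := by decide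
    have h1 := cauchySchwarz_invariants (r := 4) (by norm_num) (x + anticanonical 4 8 + negRoot 4 I)
    have hd' : (x + anticanonical 4 8 + negRoot 4 I).1 = x.1 + 2 := by
      simp [anticanonical, negRoot]; ring
    rw [quad_add, pairing_add_left, pairing_add_left _ x, pairing_negRoot_anticanonical 4 hI,
      quad_negRoot 4 hI, quad_add, pairing_self, hFq, pairing_add_left, hq, hf,
      pairing_negRoot, pairing_negRoot, hd',
      show (anticanonical 4 8).1 - ∑ i ∈ I, (anticanonical 4 8).2 i = 0 by
        simp [anticanonical, hI]] at h1
    push_cast at h1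
    nlinarith

/-- The line is the only ordered class of degree `1` with its invariants. -/
theorem eq_lineClass_of_degree_eq_one {r s : ℕ} (hr : 2 ≤ r) (hs : 2 ≤ s) {x : CurveClass s}
    (hx : Antitone x.2) (hm : ∀ i, 0 ≤ x.2 i) (hd : x.1 = 1)
    (hf : pairing r x (anticanonical r s) = 3 - r) (hq : quad r x = 3 - 2 * r) :
    x = lineClass s := by
  have hr' : (2 : ℤ) ≤ r := by exact_mod_cast hr
  have hr0 : (r : ℤ) - 1 ≠ 0 := by linarith
  rw [pairing_anticanonical, hd] at hf
  rw [quad, hd] at hq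
  have h1 : ∑ i, x.2 i = 2 := mul_left_cancel₀ hr0 (by linarith)
  have h2 : ∑ i, x.2 i ^ 2 = 2 := mul_left_cancel₀ hr0 (by linarith)
  have h3 : ∑ i, (x.2 i ^ 2 - x.2 i) = 0 := by rw [Finset.sum_sub_distrib, h1, h2, sub_self]
  have h4 : ∀ i, x.2 i ≤ 1 := by
    intro i
    have := (Finset.sum_eq_zero_iff_of_nonneg fun i _ =>
      sub_nonneg.2 (Int.le_self_sq (x.2 i))).1 h3 i (Finset.mem_univ i)
    nlinarith [hm i]
  let p : Fin s := ⟨0, by omega⟩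
  let q : Fin s := ⟨1, by omega⟩
  have hpq : p ≠ q := by simp [p, q]
  have h5 : ∀ i : Fin s, 2 ≤ (i : ℕ) → x.2 i = 0 := by
    intro i hi
    have hip : p ≠ i := by intro h; simp [← h, p] at hi
    have hiq : q ≠ i := by intro h; simp [← h, q] at hi
    have h6 : ∑ j ∈ {p, q, i}, x.2 j ≤ ∑ j, x.2 j :=
      Finset.sum_le_sum_of_subset_of_nonneg (Finset.subset_univ _) fun j _ _ => hm j
    rw [Finset.sum_insert (by simp [hpq, hip]), Finset.sum_pair hiq, h1] at h6
    have h7 : x.2 i ≤ x.2 p := hx (Fin.le_def.2 (Nat.zero_le _))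
    have h8 : x.2 i ≤ x.2 q := hx (Fin.le_def.2 (show 1 ≤ (i : ℕ) by omega))
    linarith [hm i]
  have h6 : x.2 p + x.2 q = 2 := by
    rw [← h1, ← Finset.sum_pair hpq]
    refine Finset.sum_subset (Finset.subset_univ _) fun i _ hi => h5 i ?_
    simp only [Finset.mem_insert, Finset.mem_singleton, Fin.ext_iff, p, q] at hi
    omega
  refine Prod.ext hd (funext fun i => ?_)
  simp only [lineClass]
  split_ifs with hi
  · have h7 := h4 p
    have h8 := h4 q
    obtain h | h : i = p ∨ i = q := by simp only [Fin.ext_iff, p, q]; omega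
    · rw [h]; linarith
    · rw [h]; linarith
  · exact h5 i (by omega)

/-- A pass of the reduction algorithm from an ordered Weyl line of positive degree and with
non-negative multiplicities leads to a class of the same kind, unless it starts at the line. -/
theorem IsWeylLine.eq_lineClass_or_cremona_pos {r s : ℕ} (hr : 2 ≤ r) (hs : r + 1 ≤ s)
    (hrs : r = 2 ∨ (s : ℤ) * ((r : ℤ) - 1) < ((r : ℤ) + 1) ^ 2) {x : CurveClass s}
    (hx : IsWeylLine r x) (hanti : Antitone x.2) (hd : 0 < x.1) (hm : ∀ i, 0 ≤ x.2 i)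
    (hred : ¬ IsCremonaReduced r x) :
    x = lineClass s ∨ 0 < (cremona r (firstIndices r s) x).1 ∧
      ∀ i, 0 ≤ (cremona r (firstIndices r s) x).2 i := by
  have hI := card_firstIndices hs
  rw [isCremonaReduced_iff_of_antitone hs hanti, not_le] at hred
  have hf := hx.pairing_eq (by omega)
  have hline : x.1 = 1 → x = lineClass s := fun h =>
    eq_lineClass_of_degree_eq_one hr (by omega) hanti hm h hf (hx.quad_eq (by omega))
  have hy : IsWeylLine r (cremona r (firstIndices r s) x) := cremona_mem_orbit hI hx
  have hyf := hy.pairing_eq (by omega)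
  rw [pairing_anticanonical] at hyf hf
  by_cases h2 : r = 2
  · subst h2
    by_cases hy0 : (cremona 2 (firstIndices 2 s) x).1 = 0
    · left
      apply hline
      have hyq := hy.quad_eq (by omega)
      rw [quad, hy0] at hyq
      have h1 : ∑ i ∈ firstIndices 2 s, (cremona 2 (firstIndices 2 s) x).2 i = -x.1 := by
        have : ∀ i ∈ firstIndices 2 s, (cremona 2 (firstIndices 2 s) x).2 i
            = x.2 i + (x.1 - ∑ i ∈ firstIndices 2 s, x.2 i) := fun i hi => by simp [cremona, hi]
        rw [Finset.sum_congr rfl this, Finset.sum_add_distrib, Finset.sum_const, hI]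
        simp only [cremona] at hy0
        push_cast at hy0
        simp only [nsmul_eq_mul]
        push_cast
        linarith
      have h2 : -∑ i ∈ firstIndices 2 s, (cremona 2 (firstIndices 2 s) x).2 i
          ≤ ∑ i, (cremona 2 (firstIndices 2 s) x).2 i ^ 2 := by
        rw [← Finset.sum_neg_distrib]
        refine (Finset.sum_le_sum fun i _ => ?_).trans
          (Finset.sum_le_sum_of_subset_of_nonneg (Finset.subset_univ _) fun i _ _ => sq_nonneg _)
        rw [← neg_sq]
        exact Int.le_self_sq _
      push_cast at hyq
      linarith
    · have hm' := hy.multiplicity_nonneg hs hy0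
      have := Finset.sum_nonneg fun i (_ : i ∈ Finset.univ) => hm' i
      push_cast at hyf
      exact .inr ⟨by linarith, hm'⟩
  · have hr3 : 3 ≤ r := by omega
    have hrz : (3 : ℤ) ≤ r := by exact_mod_cast hr3
    have ht : x.1 - ∑ i ∈ firstIndices r s, x.2 i = -1 := by
      have := hx.neg_one_le hr3 hs (hrs.resolve_left h2) hd hI
      omega
    by_cases h : ∃ i ∈ firstIndices r s, x.2 i = 0
    · left
      apply hline
      obtain ⟨i, hi, hi0⟩ := h
      have h1 : ∑ j, x.2 j = x.1 + 1 := by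
        rw [← Finset.sum_subset (Finset.subset_univ (firstIndices r s)) fun j _ hj => ?_]
        · linarith
        · refine le_antisymm (hi0 ▸ hanti ?_) (hm j)
          rw [mem_firstIndices] at hi hj
          exact Fin.le_def.2 (by omega)
      rw [h1] at hf
      linarith
    · push Not at h
      have hm' : ∀ i, 0 ≤ (cremona r (firstIndices r s) x).2 i := by
        intro i
        simp only [cremona, ht]
        split_ifs with hi
        · have := h i hi
          have := hm i
          omega
        · exact hm i
      refine .inr ⟨?_, hm'⟩
      have h0 := Finset.sum_nonneg fun i (_ : i ∈ Finset.univ) => hm' i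
      have hr1 : (0 : ℤ) ≤ r - 1 := by linarith
      by_contra! hneg
      -- The anticanonical degree excludes negative degrees, and in degree `0` it forces the sum
      -- of the multiplicities to be `(r - 3) / (r - 1)`, hence to vanish.
      have hd0 : (cremona r (firstIndices r s) x).1 = 0 := by
        nlinarith [mul_nonneg hr1 h0]
      rw [hd0] at hyf
      have hS : ∑ i, (cremona r (firstIndices r s) x).2 i = 0 := by
        by_contra hne
        have : 1 ≤ ∑ i, (cremona r (firstIndices r s) x).2 i := by omega
        nlinarith
      have hzero := (Finset.sum_eq_zero_iff_of_nonneg fun i _ => hm' i).1 hS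
      have hyq := hy.quad_eq (by omega)
      rw [quad, hd0, Finset.sum_eq_zero fun i hi => by rw [hzero i hi]; rfl] at hyq
      linarith

/-! ### The end of the algorithm: the line and the rational normal curve -/

/-- The reduction algorithm started at an ordered Weyl line of positive degree and with
non-negative multiplicities passes through the line. -/
theorem IsWeylLine.reflTransGen_lineClass {r s : ℕ} (hr : 2 ≤ r) (hs : r + 1 ≤ s)
    (hrs : r = 2 ∨ (s : ℤ) * ((r : ℤ) - 1) < ((r : ℤ) + 1) ^ 2)
    (hred : ∀ x : CurveClass s, IsWeylLine r x → 0 < x.1 → ¬ IsCremonaReduced r x) :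
    ∀ (k : ℕ) (x : CurveClass s), IsWeylLine r x → Antitone x.2 → 0 < x.1 → x.1 ≤ k →
      (∀ i, 0 ≤ x.2 i) → Relation.ReflTransGen (ReductionStep r) x (lineClass s) := by
  intro k
  induction k with
  | zero => intro x _ _ h1 h2; push_cast at h2; omega
  | succ k ih =>
    intro x hx hanti hd hk hm
    rcases hx.eq_lineClass_or_cremona_pos hr hs hrs hanti hd hm (hred x hx hd) with h | ⟨h1, h2⟩
    · rw [h]
    · have hstep : ReductionStep r x _ := ⟨hred x hx hd, rfl⟩
      have hlt := hstep.degree_lt hr hs hanti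
      refine .head hstep (ih _ ?_ (sortDesc_antitone _) h1 (by push_cast at hk; omega)
        fun i => h2 _)
      exact permAut_mem_orbit _ (cremona_mem_orbit (card_firstIndices hs) hx)

/-- The only class from which one pass of the reduction algorithm leads to the line is the class
of the rational normal curve through the first `r + 3` points. -/
theorem ReductionStep.eq_rncClass {r s : ℕ} (hr : 2 ≤ r) (hs : r + 1 ≤ s) {x : CurveClass s}
    (hx : Antitone x.2) (h : ReductionStep r x (lineClass s)) :
    r + 3 ≤ s ∧ x = rncClass r s := by
  obtain ⟨hred, h⟩ := h
  rw [isCremonaReduced_iff_of_antitone hs hx, not_le] at hred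
  set t := x.1 - ∑ i ∈ firstIndices r s, x.2 i with ht
  have hdeg : 1 = x.1 + (r - 1) * t := congrArg Prod.fst h
  rw [sortDesc_eq_permAut] at h
  set σ := Tuple.sort fun i => -(cremona r (firstIndices r s) x).2 i
  have hσ : ∀ i, (cremona r (firstIndices r s) x).2 i = (lineClass s).2 (σ⁻¹ i) := fun i => by
    have := congrFun (congrArg Prod.snd h) (σ⁻¹ i)
    simpa [permAut_apply] using this.symm
  have h01 : ∀ i, (lineClass s).2 i = 0 ∨ (lineClass s).2 i = 1 := fun i => by
    simp only [lineClass]; split_ifs <;> simp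
  have hin : ∀ i ∈ firstIndices r s, x.2 i = (lineClass s).2 (σ⁻¹ i) - t := fun i hi => by
    rw [← hσ]; simp [cremona, hi, ht]
  have hout : ∀ i ∉ firstIndices r s, x.2 i = (lineClass s).2 (σ⁻¹ i) := fun i hi => by
    rw [← hσ]; simp [cremona, hi]
  have hI := card_firstIndices hs
  have hr' : (2 : ℤ) ≤ r := by exact_mod_cast hr
  have hnonneg : ∀ i, 0 ≤ (lineClass s).2 i := fun i => by rcases h01 i with h | h <;> simp [h]
  -- On the first indices the line has total multiplicity `1 + t`, where `t < 0`.
  have hsum : ∑ i ∈ firstIndices r s, (lineClass s).2 (σ⁻¹ i) = 1 + t := by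
    have e := Finset.sum_congr rfl hin
    rw [Finset.sum_sub_distrib, Finset.sum_const, hI, nsmul_eq_mul] at e
    push_cast at e
    linarith
  have htm : t = -1 := by
    have := Finset.sum_nonneg fun i (_ : i ∈ firstIndices r s) => hnonneg (σ⁻¹ i)
    have : t < 0 := by linarith
    omega
  rw [htm, add_neg_cancel, Finset.sum_eq_zero_iff_of_nonneg fun i _ => hnonneg _] at hsum
  have hone : ∀ i ∈ firstIndices r s, x.2 i = 1 := fun i hi => by
    rw [hin i hi, hsum i hi, htm]; norm_num
  have hσσ : ∀ p, σ⁻¹ (σ p) = p := fun p => σ.symm_apply_apply p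
  -- The two points on the line are not among the first `r + 1` ones.
  have hpts : ∀ p : Fin s, (p : ℕ) < 2 → x.2 (σ p) = 1 ∧ r + 1 ≤ (σ p : ℕ) := by
    intro p hp
    have h1 : (lineClass s).2 p = 1 := if_pos hp
    have h2 : σ p ∉ firstIndices r s := fun hmem => by
      have := hsum _ hmem
      rw [hσσ, h1] at this
      exact one_ne_zero this
    rw [hout _ h2, hσσ]
    rw [mem_firstIndices] at h2
    exact ⟨h1, by omega⟩
  let p : Fin s := ⟨0, by omega⟩
  let q : Fin s := ⟨1, by omega⟩
  have hpq : (σ p : ℕ) ≠ σ q := by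
    rw [Ne, ← Fin.ext_iff, σ.injective.eq_iff]; simp [p, q]
  obtain ⟨hp1, hp2⟩ := hpts p (by simp [p])
  obtain ⟨hq1, hq2⟩ := hpts q (by simp [q])
  have hps := (σ p).2
  have hqs := (σ q).2
  have hother : ∀ i : Fin s, i ∉ firstIndices r s → i ≠ σ p → i ≠ σ q → x.2 i = 0 := by
    intro i hi hip hiq
    rw [hout i hi]
    simp only [lineClass, ite_eq_right_iff, one_ne_zero, imp_false, not_lt]
    by_contra! hlt
    have : σ⁻¹ i = p ∨ σ⁻¹ i = q := by simp only [Fin.ext_iff, p, q]; omega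
    rcases this with e | e <;> rw [Equiv.Perm.inv_eq_iff_eq] at e
    · exact hip e
    · exact hiq e
  -- The indices of `σ p` and `σ q` are `r + 1` and `r + 2`, as `x` is ordered.
  have hmem : ∀ i : Fin s, r + 1 ≤ (i : ℕ) → (∃ j : Fin s, i ≤ j ∧ x.2 j = 1) →
      i = σ p ∨ i = σ q := by
    rintro i hi ⟨j, hij, hj⟩
    by_contra! hne
    have h0 := hother i (by rw [mem_firstIndices]; omega) hne.1 hne.2
    have := hx hij
    omega
  refine ⟨by omega, Prod.ext ?_ (funext fun i => ?_)⟩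
  · rw [htm] at hdeg
    simp only [rncClass]
    linarith
  · simp only [rncClass]
    have h1 := hmem ⟨r + 1, by omega⟩ le_rfl ⟨σ p, hp2, hp1⟩
    obtain ⟨m, hm, hm1⟩ : ∃ m : Fin s, r + 2 ≤ (m : ℕ) ∧ x.2 m = 1 := by
      by_cases hlt : (σ p : ℕ) < r + 2
      · exact ⟨σ q, by omega, hq1⟩
      · exact ⟨σ p, by omega, hp1⟩
    have h2 := hmem ⟨r + 2, by omega⟩ (by simp) ⟨m, hm, hm1⟩
    simp only [Fin.ext_iff] at h1 h2
    by_cases hi : (i : ℕ) < r + 1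
    · rw [hone i (mem_firstIndices.2 hi), if_pos (by omega)]
    · split_ifs with hi3
      · obtain e | e : i = σ p ∨ i = σ q := by simp only [Fin.ext_iff]; omega
        · rw [e, hp1]
        · rw [e, hq1]
      · refine hother i (by rwa [mem_firstIndices]) ?_ ?_ <;>
          · rw [Ne, Fin.ext_iff]; omega

theorem isWeylLine_rncClass {r s : ℕ} (hs : r + 3 ≤ s) : IsWeylLine r (rncClass r s) := by
  -- The rational normal curve is the image of the line through the points `r + 2` and `r + 3`.
  obtain ⟨σ, hσ⟩ := exists_perm_mem_iff
    (I := {⟨r + 1, by omega⟩, ⟨r + 2, by omega⟩}) (J := {⟨0, by omega⟩, (⟨1, by omega⟩ : Fin s)})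
    (by rw [Finset.card_pair (by simp [Fin.ext_iff]), Finset.card_pair (by simp [Fin.ext_iff])])
  have hσ' : ∀ i : Fin s, (σ i : ℕ) < 2 ↔ r + 1 ≤ (i : ℕ) ∧ (i : ℕ) < r + 3 := by
    intro i
    have := hσ i
    simp only [Finset.mem_insert, Finset.mem_singleton, Fin.ext_iff] at this
    omega
  suffices e : cremona r (firstIndices r s) (permAut σ (lineClass s)) = rncClass r s from
    e ▸ cremona_mem_orbit (card_firstIndices (by omega))
      (permAut_mem_orbit σ (isWeylLine_lineClass r s))
  have hsum : ∑ i ∈ firstIndices r s, (permAut σ (lineClass s)).2 i = 0 := by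
    refine Finset.sum_eq_zero fun i hi => ?_
    rw [mem_firstIndices] at hi
    simp only [permAut_apply, lineClass, hσ']
    rw [if_neg (by omega)]
  simp only [cremona, hsum, mem_firstIndices]
  refine Prod.ext ?_ (funext fun i => ?_)
  · simp [permAut_apply, lineClass, rncClass]
  · simp only [permAut_apply, lineClass, rncClass, hσ']
    split_ifs <;> omega

theorem quad_add_zsmul_anticanonical (r : ℕ) {s : ℕ} (x : CurveClass s) (k : ℤ) :
    quad r (x + k • anticanonical r s)
      = quad r x + 2 * k * pairing r x (anticanonical r s)
        + k ^ 2 * (((r : ℤ) + 1) ^ 2 - s * ((r : ℤ) - 1)) := by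
  have h : ∑ i, (x.2 i + k) ^ 2 = ∑ i, x.2 i ^ 2 + 2 * k * ∑ i, x.2 i + s * k ^ 2 := by
    simp only [add_sq, Finset.sum_add_distrib, Finset.mul_sum, Finset.sum_const,
      Finset.card_univ, Fintype.card_fin, nsmul_eq_mul]
    congr 2
    exact Finset.sum_congr rfl fun i _ => by ring
  rw [pairing_anticanonical]
  simp only [quad, anticanonical, Prod.fst_add, Prod.snd_add, Prod.smul_fst, Prod.smul_snd,
    Pi.add_apply, Pi.smul_apply, smul_eq_mul, mul_one, h]
  ring

end CremonaCurves

open CremonaCurves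

theorem mainTheorem9 (r s : ℕ) (hr : 2 ≤ r) (hs : r + 1 ≤ s)
    (hrs : r = 2 ∨ (s : ℤ) * ((r : ℤ) - 1) < ((r : ℤ) + 1) ^ 2)
    (c : CremonaCurves.CurveClass s) (hd : 0 < c.1) (hm : ∀ i, 0 ≤ c.2 i)
    (hF : CremonaCurves.pairing r c (CremonaCurves.anticanonical r s) = 3 - (r : ℤ)) :
    (CremonaCurves.IsCremonaReduced r c → ¬ CremonaCurves.IsWeylLine r c) ∧
    ((s : ℤ) * ((r : ℤ) - 1) < ((r : ℤ) + 1) ^ 2 → ∃ R, CremonaCurves.EndsAt r c R) ∧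
    ((r = 2 → s = 9 → CremonaCurves.pairing r c c = 3 - 2 * (r : ℤ)) →
      (CremonaCurves.IsWeylLine r c ↔
        CremonaCurves.EndsAt r c (CremonaCurves.reducedClass r s)) ∧
      (CremonaCurves.IsWeylLine r c ↔
        ∃ (R : CremonaCurves.CurveClass s) (k : ℤ), CremonaCurves.EndsAt r c R ∧
          R = CremonaCurves.reducedClass r s + k • CremonaCurves.anticanonical r s) ∧
      (CremonaCurves.IsWeylLine r c ↔
        CremonaCurves.ReducesTo r c (CremonaCurves.lineClass s)) ∧
      ((∀ σ : Equiv.Perm (Fin s), c ≠ CremonaCurves.permAut σ (CremonaCurves.lineClass s)) →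
        (CremonaCurves.IsWeylLine r c ↔
          r + 3 ≤ s ∧ CremonaCurves.ReducesTo r c (CremonaCurves.rncClass r s)))) := by
  have hspec := reducedClass_spec hr hs hrs
  obtain ⟨hR, hRanti, hRred, hRdeg⟩ := hspec
  have horbit : ∀ {x}, IsWeylLine r x →
      x ∈ MulAction.orbit (weylGroup r s) (reducedClass r s) :=
    fun h => (MulAction.orbit_eq_iff.2 hR).symm ▸ h
  -- An ordered Cremona reduced Weyl line is the class in the table, whose degree is not positive.
  have hred : ∀ x : CurveClass s, IsWeylLine r x → 0 < x.1 →
      ¬ IsCremonaReduced r x := by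
    intro x hx hxd hxr
    have h := eq_of_mem_orbit_of_isCremonaReduced hs hRanti hRred
      (sortDesc_antitone x) (isCremonaReduced_permAut _ hxr)
      (permAut_mem_orbit _ (horbit hx))
    have h' := congrArg Prod.fst h
    change x.1 = _ at h'
    omega
  refine ⟨fun hcr hcw => hred c hcw hd hcr, fun h => exists_endsAt hr hs h c,
    fun h9 => ?_⟩
  have toR : IsWeylLine r c →
      EndsAt r c (reducedClass r s) := by
    intro hc
    obtain ⟨R, hR1, hR2⟩ := exists_endsAt_of_degree_ge hr hs c _ fun y hy =>
      degree_le_of_mem_orbit (by omega) hs hRanti hRred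
        (MulAction.orbit_eq_iff.2 (horbit hc) ▸ hy)
    have e := eq_of_mem_orbit_of_isCremonaReduced hs hRanti hRred hR1.antitone hR2
      (horbit ((hR1.isWeylLine_iff hs).1 hc))
    exact e ▸ ⟨hR1, hR2⟩
  have toLine : IsWeylLine r c →
      ReducesTo r c (lineClass s) := fun hc =>
    IsWeylLine.reflTransGen_lineClass hr hs hrs hred _ _
      (permAut_mem_orbit _ hc) (sortDesc_antitone c) hd
      (Int.self_le_toNat _) fun i => hm _
  refine ⟨⟨toR, fun h => (h.1.isWeylLine_iff hs).2 hR⟩, ⟨fun h => ⟨_, 0, toR h, by simp⟩, ?_⟩,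
    ⟨toLine, fun h => (h.isWeylLine_iff hs).2 (isWeylLine_lineClass r s)⟩,
    fun hne => ⟨fun hc => ?_, fun h => (h.2.isWeylLine_iff hs).2
      (isWeylLine_rncClass h.1)⟩⟩
  · rintro ⟨R, k, hend, rfl⟩
    obtain ⟨h1, h2⟩ := invariants_of_mem_orbit (hend.1.mem_orbit hs)
    have hRf := hR.pairing_eq (by omega)
    have hRq := hR.quad_eq (by omega)
    -- The two invariants of `R + k F` determine `k`.
    have hk : k = 0 := by
      have e1 : pairing r (k • anticanonical r s)
          (anticanonical r s) = k * (((r : ℤ) + 1) ^ 2 - s * ((r : ℤ) - 1)) := by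
        rw [pairing_anticanonical]
        simp [anticanonical]
        ring
      rw [pairing_add_left, e1, hRf, hF, add_eq_left, mul_eq_zero] at h1
      rcases h1 with h1 | h0
      · exact h1
      -- In the given range `⟨F, F⟩ = 0` only for `r = 2` and `s = 9`, where `⟨c, c⟩` is given.
      have hr2 : r = 2 := hrs.resolve_right (by linarith)
      subst hr2
      have hs9 : s = 9 := by push_cast at h0; omega
      rw [quad_add_zsmul_anticanonical, hRf, hRq, h0,
        ← pairing_self 2 c, h9 rfl hs9] at h2
      push_cast at h2
      linarith
    rw [hk, zero_smul, add_zero] at hend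
    exact (hend.1.isWeylLine_iff hs).2 hR
  · rcases Relation.ReflTransGen.cases_tail (toLine hc) with h | ⟨x, hx, hstep⟩
    · refine absurd ?_ (hne (Tuple.sort fun i => -c.2 i)⁻¹)
      rw [h, sortDesc_eq_permAut]
      simp [permAut_apply]
    · have hx' : ReducesTo r c x := hx
      obtain ⟨h3, rfl⟩ := hstep.eq_rncClass hr hs hx'.antitone
      exact ⟨h3, hx'⟩
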